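/- **Conventions.** A loopless multigraph $G=(V,E)$ cellularly embedded on a closed oriented surface, with face set $F$, has one qubit per edge. Its surface-code space is the joint $+1$ eigenspace of $A_v=\prod_{e\in\delta v}Z_e$ ($v\in V$) and $B_f=\prod_{e\in\partial f}X_e$ ($f\in F$), where $\delta v$ is the set of edges incident with $v$ and $\partial f$ is the set of edges that separate $f$ from other faces. Vectors need not be normalised. **Punctured cylinder graphs.** A punctured cylinder graph of genus $g$ is given by $N\ge 2$ rows, $M\ge 1$ columns and $g$ slots $(x_j,y_j,K_j)$, $j=1,\dots,g$. Slot $j$ occupies the $K_j\ge1$ columns $x_j,\dots,x_j+K_j-1$ and lies between rows $y_j$ and $y_j+1$, with $2\le y_j\le N-2$; no slot occupies the first or the last column; $x_{j+1}\ge x_j+K_j$, and $y_{j+1}\neq y_j$ if $x_{j+1}=x_j+K_j$. Its vertices are the pairs (row, column). Horizontal edges join neighbouring columns in every row. In a column without slot the vertical edges form the cycle $1\to2\to\dots\to N\to1$; in a column occupied by slot $j$ they are led through the slot and form the two cycles $1\to\dots\to y_j\to1$ and $y_j+1\to\dots\to N\to y_j+1$. The edges around each vertex have the cyclic order up, right,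 down, left, and this rotation system defines the embedding (on a surface of genus $g$). **Measurements.** The order $\mathbf{LtoR}$ measures the vertical edges of column 1, then the horizontal edges between columns 1 and 2, then the vertical edges of column 2, and so on, each column of edges from top to bottom (a vertical edge is listed at the row from which it leads downwards). Let $\widetilde E$ be the set of the first $t$ edges in this order, $1\le t\le|E|$, and $\hat E=E\setminus\widetilde E$. For $|\bar\psi\rangle$ in the code space of $G$ and a product vector $|\phi_{\widetilde E}\rangle=\bigotimes_{e\in\widetilde E}|\phi_e\rangle$ put $$p(|\phi_{\widetilde E}\rangle)=\mathrm{tr}_{\hat E}\big(\langle\phi_{\widetilde E}|\bar\psi\rangle\langle\bar\psi|\phi_{\widetilde E}\rangle\big).$$ Let $\partial\widetilde E$ be the set of vertices incident both with an edge of $\widetilde E$ and with an edge of $\hat E$, let $G(\widetilde E)$ be the subgraph formed by the edges in $\widetilde E$ and their ends, and let $G(\widetilde E_1)\cup G(\widetilde E_2)$ be two copies of $G(\widetilde E)$ glued together at the vertices of $\partial\widetilde E$. **Graph operations.** *Edge addition* adds a new edge between two existing vertices, or a new vertex joined by a new edge to an existing one; the new edge is assigned the state $|0\rangle$. *Vertex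 splitting* splits a vertex into two, divides the incident edge ends arbitrarily between them and joins them by a new edge; the new edge is assigned the state $|+\rangle$. **Theorem.** Let $G$ be a punctured cylinder graph of genus $g$ and $\widetilde E$ the set of measured edges at any step $1\le t\le |E|$ of $\mathbf{LtoR}$. There is a punctured cylinder graph $G'(\widetilde E)$ of genus at most $2g$, depending only on $G$ and $\widetilde E$, whose underlying graph is obtained from $G(\widetilde E_1)\cup G(\widetilde E_2)$ by finitely many edge additions and vertex splittings, adding a set $\bar E$ of new edges, such that the following holds. For every $|\bar\psi\rangle$ in the code space of $G$ there is a vector $|\bar\psi(G'(\widetilde E))\rangle$ in the code space of $G'(\widetilde E)$ such that for all product vectors $|\phi_{\widetilde E}\rangle$ $$p(|\phi_{\widetilde E}\rangle)=\alpha\,\langle\phi(G'(\widetilde E))|\bar\psi(G'(\widetilde E))\rangle,\qquad \alpha=\sqrt{2^{|\bar E|+1}/2^{|\partial\widetilde E|}},$$ where $|\phi(G'(\widetilde E))\rangle$ is the product vector with $|\phi_e\rangle$ on the first copy of each $e\in\widetilde E$, the complex conjugate $|\phi_e^*\rangle$ on the second copy, and the assigned state $|0\rangle$ or $|+\rangle$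 on each edge of $\bar E$. -/

import Mathlib

open scoped Classical ComplexConjugate

/-! ### Qubit registers -/

/-- Vectors of a register of qubits indexed by `E`, as amplitudes in the computational (Pauli `Z`)
basis `|x⟩`, `x : E → ZMod 2`.  Vectors are not required to be normalised. -/
abbrev QState (E : Type) : Type := (E → ZMod 2) → ℂ

/-- A single-qubit vector `a |0⟩ + b |1⟩`, as the function `0 ↦ a`, `1 ↦ b`. -/
abbrev Qubit : Type := ZMod 2 → ℂ

/-- The bitstring of a set of edges. -/
noncomputable def bits {E : Type} (S : Finset E) : E → ZMod 2 := fun e => if e ∈ S then 1 else 0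

/-- `∏_{e ∈ S} Z_e`, that is `|x⟩ ↦ (-1)^{|x ∩ S|} |x⟩`. -/
noncomputable def pauliZ {E : Type} (S : Finset E) : QState E →ₗ[ℂ] QState E where
  toFun ψ := fun x => (∏ e ∈ S, if x e = 1 then (-1 : ℂ) else 1) * ψ x
  map_add' ψ χ := by funext x; simp [mul_add]
  map_smul' a ψ := by funext x; simp [mul_left_comm]

/-- `∏_{e ∈ S} X_e`, that is `|x⟩ ↦ |x ⊕ S⟩`. -/
noncomputable def pauliX {E : Type} (S : Finset E) : QState E →ₗ[ℂ] QState E where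
  toFun ψ := fun x => ψ (x + bits S)
  map_add' ψ χ := by funext x; simp
  map_smul' a ψ := by funext x; simp

/-- The product vector `⨂_e φ_e`. -/
noncomputable def productState {E : Type} [Fintype E] (φ : E → Qubit) : QState E :=
  fun x => ∏ e, φ e (x e)

/-- The inner product `⟨φ|ψ⟩`, conjugate-linear in `φ`. -/
noncomputable def braket {E : Type} [Fintype E] (φ ψ : QState E) : ℂ :=
  ∑ x, conj (φ x) * ψ x

/-- The bitstring on all of `E` that is `x` on `S` and `y` off `S`. -/
noncomputable def joinBits {E : Type} (S : Finset E) (x : {e // e ∈ S} → ZMod 2)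
    (y : {e // e ∉ S} → ZMod 2) : E → ZMod 2 :=
  fun e => if h : e ∈ S then x ⟨e, h⟩ else y ⟨e, h⟩

/-- The partial inner product `⟨φ|ψ⟩` for `φ` a vector of the qubits in `S`: a vector of the
remaining qubits. -/
noncomputable def partialBraket {E : Type} [Fintype E] (S : Finset E) (φ : QState {e // e ∈ S})
    (ψ : QState E) : QState {e // e ∉ S} :=
  fun y => ∑ x, conj (φ x) * ψ (joinBits S x y)

/-- The partial measurement probability `tr (⟨φ|ψ⟩⟨ψ|φ⟩)`, the trace being over the qubits not in
`S`, where `φ` is the product of the single-qubit outcomes `φ_e`, `e ∈ S`. -/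
noncomputable def partialProb {E : Type} [Fintype E] (S : Finset E) (ψ : QState E)
    (φ : {e // e ∈ S} → Qubit) : ℝ :=
  ∑ y, ‖partialBraket S (productState φ) ψ y‖ ^ 2

/-! ### Embedded graphs and the surface code -/

/-- A loopless multigraph with vertex set `V` and edge set `E`, cellularly embedded on a closed
oriented surface, given by its rotation system.  The edge `e` has two darts (half-edges)
`(e, false)` and `(e, true)`; `src` is the vertex at which a dart starts, and `rot` sends a dart to
the next one in clockwise order around its vertex. -/
structure EmbeddedGraph (V E : Type) where
  src : E × Bool → V
  rot : Equiv.Perm (E × Bool)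
  src_rot : ∀ d, src (rot d) = src d
  rot_cycle : ∀ d d', src d = src d' → rot.SameCycle d d'
  loopless : ∀ e, src (e, false) ≠ src (e, true)

/-- The exchange of the two darts of every edge. -/
def revDart (E : Type) : Equiv.Perm (E × Bool) where
  toFun d := (d.1, !d.2)
  invFun d := (d.1, !d.2)
  left_inv d := by simp
  right_inv d := by simp

namespace EmbeddedGraph

variable {V E : Type} (G : EmbeddedGraph V E)

/-- One step along the boundary of the face to the left of a dart: traverse the dart, then turn to
the next dart around the vertex that has been reached. -/
def faceStep : Equiv.Perm (E × Bool) := (revDart E).trans G.rot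

/-- The faces of the embedding are the orbits of `faceStep`. -/
abbrev Face : Type := Quotient (Equiv.Perm.SameCycle.setoid G.faceStep)

/-- The face to the left of a dart. -/
def faceOf (d : E × Bool) : G.Face := Quotient.mk _ d

/-- `v` is an end of `e`. -/
def Incident (v : V) (e : E) : Prop := G.src (e, false) = v ∨ G.src (e, true) = v

/-- `δv`, the set of edges incident with `v`. -/
noncomputable def star [Fintype E] (v : V) : Finset E := {e | G.Incident v e}

/-- `∂f`, the set of edges that separate the face `f` from other faces. -/
noncomputable def bdry [Fintype E] (f : G.Face) : Finset E :=
  {e | Xor (G.faceOf (e, false) = f) (G.faceOf (e, true) = f)}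

/-- The surface-code space, the joint `+1` eigenspace of `A_v = ∏_{e ∈ δv} Z_e` for all vertices and
`B_f = ∏_{e ∈ ∂f} X_e` for all faces. -/
noncomputable def codeSpace [Fintype E] : Submodule ℂ (QState E) where
  carrier := {ψ | (∀ v, pauliZ (G.star v) ψ = ψ) ∧ ∀ f, pauliX (G.bdry f) ψ = ψ}
  zero_mem' := by simp
  add_mem' := by
    rintro ψ χ ⟨h1, h2⟩ ⟨h3, h4⟩
    exact ⟨fun v => by rw [map_add, h1, h3], fun f => by rw [map_add, h2, h4]⟩
  smul_mem' := by
    rintro a ψ ⟨h1, h2⟩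
    exact ⟨fun v => by rw [map_smul, h1], fun f => by rw [map_smul, h2]⟩

/-- The vertices that have at least one incident edge in `S`. -/
def touched (S : Finset E) : Set V := {v | ∃ e ∈ S, G.Incident v e}

/-- `∂S`, the vertices that have an incident edge in `S` and an incident edge not in `S`. -/
def boundary (S : Finset E) : Set V := {v | (∃ e ∈ S, G.Incident v e) ∧ ∃ e ∉ S, G.Incident v e}

end EmbeddedGraph

/-! ### Doubling, edge addition and vertex splitting -/

/-- Labels for the edges of an effective graph: the first or second copy of a measured edge, an edge
measured in `|0⟩`, or an edge measured in `|+⟩`. -/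
inductive EdgeLabel (A : Type) : Type
  | fst (e : A)
  | snd (e : A)
  | zero
  | plus

/-- The single-qubit vector belonging to a label: `φ_e` on the first copy of `e`, its entrywise
complex conjugate `φ_e^*` on the second copy, `|0⟩` and `|+⟩` on the auxiliary edges. -/
noncomputable def EdgeLabel.qubit {A : Type} (φ : A → Qubit) : EdgeLabel A → Qubit
  | .fst e => φ e
  | .snd e => fun b => conj (φ e b)
  | .zero => fun b => if b = 0 then 1 else 0
  | .plus => fun _ => ((Real.sqrt 2)⁻¹ : ℝ)

/-- A multigraph with labelled edges. -/
structure LabelledGraph (A : Type) : Type 1 where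
  V : Type
  E : Type
  ends : E → Sym2 V
  lab : E → EdgeLabel A

namespace LabelledGraph

variable {A : Type}

/-- Edge addition: a new edge between two existing vertices, measured in `|0⟩`. -/
def addEdge (H : LabelledGraph A) (u v : H.V) : LabelledGraph A where
  V := H.V
  E := Option H.E
  ends e := e.elim s(u, v) H.ends
  lab e := e.elim .zero H.lab

/-- Edge addition: a new vertex, connected to the graph by a new edge measured in `|0⟩`. -/
def addPendant (H : LabelledGraph A) (u : H.V) : LabelledGraph A where
  V := Option H.V
  E := Option H.E
  ends e := e.elim s(some u, none) (fun e => (H.ends e).map some)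
  lab e := e.elim .zero H.lab

/-- Vertex splitting: the vertex `v` is split into `some v` and `none`, which are joined by a new
edge measured in `|+⟩`; `newEnds` tells how the old edges are divided between the two. -/
def splitVertex (H : LabelledGraph A) (v : H.V) (newEnds : H.E → Sym2 (Option H.V)) :
    LabelledGraph A where
  V := Option H.V
  E := Option H.E
  ends e := e.elim s(some v, none) newEnds
  lab e := e.elim .plus H.lab

/-- One edge addition, one vertex splitting, or a renaming of vertices and edges. -/
inductive Step : LabelledGraph A → LabelledGraph A → Prop
  | iso (H K : LabelledGraph A) (f : H.V ≃ K.V) (h : H.E ≃ K.E)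
      (hends : ∀ e, K.ends (h e) = (H.ends e).map f) (hlab : ∀ e, K.lab (h e) = H.lab e) : Step H K
  | addEdge (H : LabelledGraph A) (u v : H.V) : Step H (H.addEdge u v)
  | addPendant (H : LabelledGraph A) (u : H.V) : Step H (H.addPendant u)
  | splitVertex (H : LabelledGraph A) (v : H.V) (newEnds : H.E → Sym2 (Option H.V))
      (hnew : ∀ e, (newEnds e).map (fun w => w.getD v) = H.ends e) : Step H (H.splitVertex v newEnds)

/-- `K` is obtained from `H` by finitely many edge additions and vertex splittings. -/
def Expands (H K : LabelledGraph A) : Prop := Relation.ReflTransGen Step H K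

end LabelledGraph

namespace EmbeddedGraph

variable {V E : Type} (G : EmbeddedGraph V E)

/-- The underlying multigraph of `G`, with labels on its edges. -/
def labelled {A : Type} (lab : E → EdgeLabel A) : LabelledGraph A where
  V := V
  E := E
  ends e := s(G.src (e, false), G.src (e, true))
  lab := lab

/-- The vertices of two copies of the subgraph with edge set `S`, glued along `∂S`: a boundary
vertex `v` is represented by `(v, false)` only. -/
abbrev DoubleVertex (S : Finset E) : Type :=
  {p : V × Bool // p.1 ∈ G.touched S ∧ (p.1 ∈ G.boundary S → p.2 = false)}

/-- The vertex `v` of copy number `b`. -/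
noncomputable def copyVertex (S : Finset E) (b : Bool) (v : V) (hv : v ∈ G.touched S) :
    G.DoubleVertex S :=
  if h : v ∈ G.boundary S then ⟨(v, false), hv, fun _ => rfl⟩
  else ⟨(v, b), hv, fun h' => absurd h' h⟩

/-- Two copies of the subgraph with edge set `S` (edges in `S` and the vertices they touch), glued
together at the vertices of `∂S`. -/
noncomputable def double (S : Finset E) : LabelledGraph {e // e ∈ S} where
  V := G.DoubleVertex S
  E := {e // e ∈ S} × Bool
  ends e := s(G.copyVertex S e.2 (G.src (e.1.1, false)) ⟨e.1.1, e.1.2, Or.inl rfl⟩,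
    G.copyVertex S e.2 (G.src (e.1.1, true)) ⟨e.1.1, e.1.2, Or.inr rfl⟩)
  lab e := if e.2 then .snd e.1 else .fst e.1

end EmbeddedGraph

/-! ### Punctured cylinder graphs -/

/-- A slot: it occupies the `K` columns `x, …, x + K - 1` (columns are numbered from `0`) and lies
below exactly `y` of the rows. -/
structure Slot where
  x : ℕ
  y : ℕ
  K : ℕ

/-- The parameters of a punctured cylinder graph: `N` rows, `M` columns, and the slots from left to
right, no two of which are above one another.

`rows` and `slot_rows` say that there are no self-loops.  The other conditions express that the
embedding on the surface with one handle for each slot is cellular: the first and last column are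
not slotted, and two slots in the same row gap are separated by at least one column. -/
structure PuncturedCylinder where
  N : ℕ
  M : ℕ
  slots : List Slot
  rows : 2 ≤ N
  columns : 1 ≤ M
  slot_width : ∀ s ∈ slots, 1 ≤ s.K
  slot_rows : ∀ s ∈ slots, 2 ≤ s.y ∧ s.y + 2 ≤ N
  slot_columns : ∀ s ∈ slots, 1 ≤ s.x ∧ s.x + s.K + 1 ≤ M
  slot_order : slots.Pairwise fun s s' =>
    s.x + s.K ≤ s'.x ∧ (s.x + s.K = s'.x → s.y ≠ s'.y)

namespace PuncturedCylinder

variable (P : PuncturedCylinder)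

/-- The genus: every slot is a hole drilled through the solid disk. -/
def genus : ℕ := P.slots.length

/-- The vertex `(i, c)` is in row `i` and column `c`. -/
abbrev Vertex : Type := Fin P.N × Fin P.M

/-- The edge `inl (i, c)` is the vertical edge of column `c` that leaves `(i, c)` downwards; the edge
`inr (i, c)` is the horizontal edge between `(i, c)` and `(i, c + 1)`. -/
abbrev Edge : Type := (Fin P.N × Fin P.M) ⊕ (Fin P.N × Fin (P.M - 1))

/-- The number `y` of rows above the slot that occupies column `c`, or `0` if there is none. -/
def cut (c : ℕ) : ℕ :=
  match P.slots.find? (fun s => decide (s.x ≤ c ∧ c < s.x + s.K)) with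
  | some s => s.y
  | none => 0

lemma cut_cases (c : ℕ) : P.cut c = 0 ∨ (2 ≤ P.cut c ∧ P.cut c + 2 ≤ P.N) := by
  unfold cut
  split
  · next s hs => exact Or.inr (P.slot_rows s (List.mem_of_find?_eq_some hs))
  · exact Or.inl rfl

/-- The vertical adjacency in a column, sending a row to the row below it.  In a column without slot
it is the cycle `0 → 1 → ⋯ → N - 1 → 0`.  In a column with a slot below `y` rows, the vertical edges
are led through the slot and form two cycles, `0 → ⋯ → y - 1 → 0` and `y → ⋯ → N - 1 → y`. -/
def below (c : ℕ) : Equiv.Perm (Fin P.N) where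
  toFun i :=
    if i.1 + 1 = P.cut c then ⟨0, by have := i.2; omega⟩
    else if h : i.1 + 1 = P.N then
      ⟨P.cut c, by have := P.cut_cases c; have := P.rows; omega⟩
    else ⟨i.1 + 1, by have := i.2; omega⟩
  invFun i :=
    if i.1 = P.cut c then ⟨P.N - 1, by have := i.2; omega⟩
    else if i.1 = 0 then
      ⟨P.cut c - 1, by have := P.cut_cases c; have := P.rows; omega⟩
    else ⟨i.1 - 1, by have := i.2; omega⟩
  left_inv i := by
    have h1 := P.cut_cases c
    have h2 := i.2
    ext
    dsimp only
    split_ifs <;> simp_all <;> omega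
  right_inv i := by
    have h1 := P.cut_cases c
    have h2 := i.2
    have h3 := P.rows
    ext
    dsimp only
    split_ifs <;> (try simp only at *) <;> first | omega | (exfalso; simp at *; omega)

/-- The start of a dart: `false` is the upper or left end of an edge, `true` the lower or right. -/
def src : P.Edge × Bool → P.Vertex
  | (.inl (i, c), false) => (i, c)
  | (.inl (i, c), true) => (P.below c i, c)
  | (.inr (i, c), false) => (i, ⟨c.1, by have := c.2; omega⟩)
  | (.inr (i, c), true) => (i, ⟨c.1 + 1, by have := c.2; omega⟩)

/-- The rotation at a vertex: up, right, down, left, up, …, where the left dart is absent in the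
first column and the right dart is absent in the last column. -/
def rotFun : P.Edge × Bool → P.Edge × Bool
  | (.inl (i, c), true) =>
      if h : c.1 + 1 < P.M then (.inr (P.below c i, ⟨c.1, by omega⟩), false)
      else (.inl (P.below c i, c), false)
  | (.inr (i, c), false) => (.inl (i, ⟨c.1, by have := c.2; omega⟩), false)
  | (.inl (i, c), false) =>
      if h : 0 < c.1 then (.inr (i, ⟨c.1 - 1, by have := c.2; omega⟩), true)
      else (.inl ((P.below c).symm i, c), true)
  | (.inr (i, c), true) =>
      (.inl ((P.below (c.1 + 1)).symm i, ⟨c.1 + 1, by have := c.2; omega⟩), true)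

/-- The inverse of `rotFun`. -/
def rotInv : P.Edge × Bool → P.Edge × Bool
  | (.inl (i, c), false) =>
      if h : c.1 + 1 < P.M then (.inr (i, ⟨c.1, by omega⟩), false)
      else (.inl ((P.below c).symm i, c), true)
  | (.inr (i, c), false) =>
      (.inl ((P.below c).symm i, ⟨c.1, by have := c.2; omega⟩), true)
  | (.inl (i, c), true) =>
      if h : 0 < c.1 then (.inr (P.below c i, ⟨c.1 - 1, by have := c.2; omega⟩), true)
      else (.inl (P.below c i, c), false)
  | (.inr (i, c), true) => (.inl (i, ⟨c.1 + 1, by have := c.2; omega⟩), false)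

/-- The rotation as a permutation of the darts. -/
def rot : Equiv.Perm (P.Edge × Bool) where
  toFun := P.rotFun
  invFun := P.rotInv
  left_inv := by
    rintro ⟨⟨i, c⟩ | ⟨i, c⟩, _ | _⟩
    · by_cases h : 0 < c.1
      · have : c.1 - 1 + 1 = c.1 := by omega
        simp [rotFun, rotInv, h, this]
      · simp [rotFun, rotInv, h]
    · by_cases h : c.1 + 1 < P.M <;> simp [rotFun, rotInv, h]
    · have := c.2
      have h : c.1 + 1 < P.M := by omega
      simp [rotFun, rotInv, h]
    · simp [rotFun, rotInv]
  right_inv := by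
    rintro ⟨⟨i, c⟩ | ⟨i, c⟩, _ | _⟩
    · by_cases h : c.1 + 1 < P.M <;> simp [rotFun, rotInv, h]
    · by_cases h : 0 < c.1
      · have : c.1 - 1 + 1 = c.1 := by omega
        simp [rotFun, rotInv, h, this]
      · simp [rotFun, rotInv, h]
    · have := c.2
      have h : c.1 + 1 < P.M := by omega
      simp [rotFun, rotInv, h]
    · simp [rotFun, rotInv]

lemma src_rot (d : P.Edge × Bool) : P.src (P.rot d) = P.src d := by
  change P.src (P.rotFun d) = P.src d
  rcases d with ⟨⟨i, c⟩ | ⟨i, c⟩, _ | _⟩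
  · by_cases h : 0 < c.1
    · have : c.1 - 1 + 1 = c.1 := by omega
      simp [rotFun, src, h, this]
    · simp [rotFun, src, h]
  · by_cases h : c.1 + 1 < P.M <;> simp [rotFun, src, h]
  · simp [rotFun, src]
  · simp [rotFun, src]

lemma sameCycle_down (d : P.Edge × Bool) : P.rot.SameCycle d (.inl (P.src d), false) := by
  have step : ∀ d d', P.rotFun d = d' → P.rot.SameCycle d' (.inl (P.src d), false) →
      P.rot.SameCycle d (.inl (P.src d), false) := by
    intro d d' h h'
    have h2 : P.rot d = d' := h
    rw [← h2] at h'
    exact Equiv.Perm.sameCycle_apply_left.mp h'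
  have up : ∀ i c, P.rot.SameCycle (.inl (i, c), true)
      (.inl (P.src (.inl (i, c), true)), false) := by
    intro i c
    by_cases h : c.1 + 1 < P.M
    · refine step _ (.inr (P.below c i, ⟨c.1, by omega⟩), false) (by simp [rotFun, h]) ?_
      rw [← Equiv.Perm.sameCycle_apply_left]
      exact Equiv.Perm.SameCycle.refl _ _
    · refine step _ (.inl (P.below c i, c), false) (by simp [rotFun, h]) ?_
      exact Equiv.Perm.SameCycle.refl _ _
  rcases d with ⟨⟨i, c⟩ | ⟨i, c⟩, _ | _⟩
  · exact Equiv.Perm.SameCycle.refl _ _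
  · exact up i c
  · exact step _ _ rfl (Equiv.Perm.SameCycle.refl _ _)
  · have := up ((P.below (c.1 + 1)).symm i) ⟨c.1 + 1, by have := c.2; omega⟩
    refine step _ (.inl ((P.below (c.1 + 1)).symm i, ⟨c.1 + 1, by have := c.2; omega⟩), true)
      rfl ?_
    simpa [src] using this

lemma below_ne (c : ℕ) (i : Fin P.N) : P.below c i ≠ i := by
  have h1 := P.cut_cases c
  have h2 := i.2
  have h3 := P.rows
  intro h
  have h := congrArg Fin.val h
  simp only [below, Equiv.coe_fn_mk] at h
  split_ifs at h <;> simp_all <;> omega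

/-- The punctured cylinder graph with its embedding. -/
def graph : EmbeddedGraph P.Vertex P.Edge where
  src := P.src
  rot := P.rot
  src_rot := P.src_rot
  rot_cycle d d' h := by
    have h1 := P.sameCycle_down d
    have h2 := P.sameCycle_down d'
    rw [h] at h1
    exact h1.trans h2.symm
  loopless := by
    rintro (⟨i, c⟩ | ⟨i, c⟩) h
    · exact P.below_ne c i (congrArg Prod.fst h).symm
    · simp [src] at h

/-- The position of an edge in the measurement order from left to right: the vertical edges of the
first column, then the horizontal edges between the first two columns, then the vertical edges of
the second column, and so on; within a column of vertical or horizontal edges, from top to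
bottom. -/
def position : P.Edge → ℕ
  | .inl (i, c) => 2 * P.N * c.1 + i.1
  | .inr (i, c) => 2 * P.N * c.1 + P.N + i.1

/-- The set of edges that have been measured after `t` measurements. -/
def measured (t : ℕ) : Finset P.Edge := {e | P.position e < t}

end PuncturedCylinder

/-! A code state is a function on mod 2 homology: its amplitudes are supported on cycles and
invariant under adding face boundaries (`mem_codeSpace_iff`). Expanding the square in the partial
probability gives a sum over pairs `(x, x')` of bitstrings on the measured edges, weighted by the
reduced kernel `∑ y, ψ(x, y) * conj ψ(x', y)`. A pair contributes only if some common `y` completes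
both strings to cycles. Such a pair should be a single cycle on two copies of the measured part
glued along the boundary, and the kernel should be a code state there.

`Represents` isolates what a labelled embedded graph must satisfy for this: its cycles that avoid
the `zero` edges are determined by their restrictions to the two copies, every completable pair of
strings arises from one, and if such a cycle is a boundary then it comes from two boundaries of `G`
that agree off the measured set. The kernel is invariant under the last kind of pair
(`reducedKernel_add`), hence descends to homology classes and extends to a code state
(`representingState`). Its overlap with the product vector is the probability times a nonzero
constant. Since states are not normalised, any nonzero prefactor can then be absorbed
(`Represents.exists_state`).

The graph is the mirror double of the columns up to the front column `c`, reflected in column `c +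
1`. Slots left of the mirror column are doubled and a slot through it is symmetrised, so the genus
is at most doubled. Unmeasured horizontal edges next to the mirror column are contracted (`plus`)
where the two copies have to be glued and deleted (`zero`) where they must stay apart; unmeasured
vertical edges are deleted. The exception is a front in column 0, where the untouched vertices are
contracted along the column. `IsFront.represents` verifies the homological conditions, and
`IsFront.isContraction` together with `expands_of_isContraction` shows that the contraction and
deletion yield the doubled graph. -/

lemma ZMod.two_cases (u : ZMod 2) : u = 0 ∨ u = 1 := by
  revert u; decide

/-! ### Code states as functions on mod 2 homology. -/

namespace EmbeddedGraph

variable {V E : Type} (G : EmbeddedGraph V E)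

/-- The cycle space modulo 2. -/
noncomputable def cycles [Fintype E] : AddSubgroup (E → ZMod 2) where
  carrier := {z | ∀ v, ∑ e ∈ G.star v, z e = 0}
  zero_mem' := by simp
  add_mem' := by
    intro a b ha hb v
    simp only [Pi.add_apply, Finset.sum_add_distrib, ha v, hb v, add_zero]
  neg_mem' := by
    intro a ha v
    simp only [Pi.neg_apply, Finset.sum_neg_distrib, ha v, neg_zero]

/-- The space of boundaries of sets of faces, modulo 2. -/
def boundaries : AddSubgroup (E → ZMod 2) where
  carrier := {z | ∃ σ : E × Bool → ZMod 2, (∀ d, σ (G.faceStep d) = σ d) ∧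
    ∀ e, z e = σ (e, false) + σ (e, true)}
  zero_mem' := ⟨0, by simp, by simp⟩
  add_mem' := by
    rintro a b ⟨σ, h1, h2⟩ ⟨τ, h3, h4⟩
    exact ⟨σ + τ, by simp [h1, h3], fun e => by simp only [Pi.add_apply, h2, h4]; ring⟩
  neg_mem' := by
    rintro a ⟨σ, h1, h2⟩
    exact ⟨-σ, by simp [h1], fun e => by simp only [Pi.neg_apply, h2]; ring⟩

lemma prod_sign (S : Finset E) (x : E → ZMod 2) :
    (∏ e ∈ S, if x e = 1 then (-1 : ℂ) else 1) = if ∑ e ∈ S, x e = 0 then 1 else -1 := by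
  induction S using Finset.induction_on with
  | empty => simp
  | insert a S ha ih =>
    rw [Finset.prod_insert ha, Finset.sum_insert ha, ih]
    rcases ZMod.two_cases (∑ e ∈ S, x e) with h | h <;>
      rcases ZMod.two_cases (x a) with h' | h' <;> simp [h, h', CharTwo.add_self_eq_zero]

lemma faceOf_faceStep (d : E × Bool) : G.faceOf (G.faceStep d) = G.faceOf d :=
  Quotient.sound (s := Equiv.Perm.SameCycle.setoid G.faceStep)
    (Equiv.Perm.sameCycle_apply_left.mpr (Equiv.Perm.SameCycle.refl _ _))

lemma pauliZ_eq_iff (S : Finset E) (ψ : QState E) :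
    pauliZ S ψ = ψ ↔ ∀ x, ψ x ≠ 0 → ∑ e ∈ S, x e = 0 := by
  rw [funext_iff]
  refine forall_congr' fun x => ?_
  change (∏ e ∈ S, if x e = 1 then (-1 : ℂ) else 1) * ψ x = ψ x ↔ _
  rw [prod_sign]
  split_ifs with h
  · simp [h]
  · simp only [neg_mul, one_mul, h, imp_false, not_not]
    exact self_eq_neg.symm.trans eq_comm |>.symm.trans (by simp)

variable [Fintype E]

lemma mem_cycles {z : E → ZMod 2} : z ∈ G.cycles ↔ ∀ v, ∑ e ∈ G.star v, z e = 0 := Iff.rfl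

/-- By looplessness every edge at `v` has exactly one dart starting at `v`. -/
lemma sum_star (v : V) (z : E → ZMod 2) :
    ∑ e ∈ G.star v, z e = ∑ d : E × Bool, if G.src d = v then z d.1 else 0 := by
  rw [Fintype.sum_prod_type, star, Finset.sum_filter]
  refine Finset.sum_congr rfl fun e _ => ?_
  have := G.loopless e
  simp only [Fintype.sum_bool, Incident]
  by_cases h1 : G.src (e, false) = v <;> by_cases h2 : G.src (e, true) = v <;> simp_all

/-- Since `faceStep` of the reversed dart is `rot d`, the edge of `d` has bit `σ d + σ (rot d)`. The
rotation permutes the darts at `v`, so every value of `σ` occurs twice in the sum around `v`. -/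
lemma boundaries_le_cycles : G.boundaries ≤ G.cycles := by
  rintro z ⟨σ, h1, h2⟩ v
  rw [G.sum_star]
  have key : ∀ d : E × Bool, z d.1 = σ d + σ (G.rot d) := by
    rintro ⟨e, b⟩
    have := h1 (e, !b)
    simp only [faceStep, Equiv.trans_apply, revDart, Equiv.coe_fn_mk, Bool.not_not] at this
    rw [h2, this]
    cases b <;> simp [add_comm]
  have h3 : ∑ d : E × Bool, (if G.src d = v then σ (G.rot d) else 0) =
      ∑ d : E × Bool, if G.src d = v then σ d else 0 := by
    rw [← Equiv.sum_comp G.rot (fun d => if G.src d = v then σ d else 0)]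
    simp only [G.src_rot]
  calc ∑ d : E × Bool, (if G.src d = v then z d.1 else 0)
      = ∑ d : E × Bool, ((if G.src d = v then σ d else 0) +
          if G.src d = v then σ (G.rot d) else 0) := by
        refine Finset.sum_congr rfl fun d _ => ?_
        split_ifs <;> simp [key]
    _ = 0 := by rw [Finset.sum_add_distrib, h3, CharTwo.add_self_eq_zero]

lemma bits_bdry (f : G.Face) (e : E) :
    bits (G.bdry f) e = (if G.faceOf (e, false) = f then 1 else 0) +
      if G.faceOf (e, true) = f then 1 else 0 := by
  have h : e ∈ G.bdry f ↔ Xor (G.faceOf (e, false) = f) (G.faceOf (e, true) = f) := by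
    simp only [bdry, Finset.mem_filter, Finset.mem_univ, true_and]
  simp only [bits, h]
  by_cases h1 : G.faceOf (e, false) = f <;> by_cases h2 : G.faceOf (e, true) = f <;>
    simp [h1, h2, CharTwo.add_self_eq_zero]

lemma bits_bdry_mem (f : G.Face) : bits (G.bdry f) ∈ G.boundaries :=
  ⟨fun d => if G.faceOf d = f then 1 else 0, fun d => by simp only [G.faceOf_faceStep],
    G.bits_bdry f⟩

/-- The function `σ` is constant on face orbits and so descends to a set of faces; the boundary of
that set is the sum of the boundaries of its members. -/
lemma boundaries_le_closure :
    G.boundaries ≤ AddSubgroup.closure (Set.range fun f => bits (G.bdry f)) := by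
  rintro z ⟨σ, h1, h2⟩
  have hσ : ∀ d d', G.faceStep.SameCycle d d' → σ d = σ d' := by
    have hpow : ∀ (n : ℕ) d, σ ((G.faceStep ^ n) d) = σ d := by
      intro n
      induction n with
      | zero => simp
      | succ n ih => intro d; rw [pow_succ', Equiv.Perm.mul_apply, h1, ih]
    intro d d' h
    obtain ⟨n, rfl⟩ := h.exists_nat_pow_eq
    exact (hpow n d).symm
  let s : G.Face → ZMod 2 := Quotient.lift σ hσ
  have hz : z = ∑ f : G.Face, if s f = 1 then bits (G.bdry f) else 0 := by
    funext e
    rw [Finset.sum_apply]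
    have h3 : ∀ f : G.Face, (if s f = 1 then bits (G.bdry f) else 0) e =
        (if G.faceOf (e, false) = f then s f else 0) +
          if G.faceOf (e, true) = f then s f else 0 := by
      intro f
      rcases ZMod.two_cases (s f) with h | h <;> simp [h, G.bits_bdry]
    simp only [h3, Finset.sum_add_distrib, Finset.sum_ite_eq, Finset.mem_univ, if_true]
    exact h2 e
  rw [hz]
  refine AddSubgroup.sum_mem _ fun f _ => ?_
  split_ifs
  · exact AddSubgroup.subset_closure ⟨f, rfl⟩
  · exact AddSubgroup.zero_mem _

/-- The vertex stabilisers constrain the support and the face stabilisers give invariance under the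
generators of `boundaries`. -/
lemma mem_codeSpace_iff {ψ : QState E} :
    ψ ∈ G.codeSpace ↔ (∀ x, ψ x ≠ 0 → x ∈ G.cycles) ∧
      ∀ b ∈ G.boundaries, ∀ x, ψ (x + b) = ψ x := by
  constructor
  · rintro ⟨h1, h2⟩
    refine ⟨fun x hx v => (pauliZ_eq_iff _ _).mp (h1 v) x hx, fun b hb => ?_⟩
    replace hb := G.boundaries_le_closure hb
    induction hb using AddSubgroup.closure_induction with
    | mem b hb =>
      obtain ⟨f, rfl⟩ := hb
      exact fun x => congrFun (h2 f) x
    | zero => simp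
    | add a b _ _ ha hb => exact fun x => by rw [← add_assoc, hb, ha]
    | neg a _ ha => exact fun x => by rw [← ha (x + -a), neg_add_cancel_right]
  · rintro ⟨h1, h2⟩
    exact ⟨fun v => (pauliZ_eq_iff _ _).mpr fun x hx => h1 x hx v,
      fun f => funext fun x => h2 _ (G.bits_bdry_mem f) x⟩

end EmbeddedGraph

/-! ### Partial probabilities and the reduced kernel. -/

lemma joinBits_of_mem {E : Type} {S : Finset E} (x : {e // e ∈ S} → ZMod 2)
    (y : {e // e ∉ S} → ZMod 2) (e : {e // e ∈ S}) : joinBits S x y e.1 = x e := by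
  simp [joinBits, e.2]

lemma joinBits_of_notMem {E : Type} {S : Finset E} (x : {e // e ∈ S} → ZMod 2)
    (y : {e // e ∉ S} → ZMod 2) (e : {e // e ∉ S}) : joinBits S x y e.1 = y e := by
  simp [joinBits, e.2]

lemma joinBits_add {E : Type} {S : Finset E} (x : {e // e ∈ S} → ZMod 2)
    (y : {e // e ∉ S} → ZMod 2) (u : E → ZMod 2) :
    joinBits S (fun e => x e + u e) (fun e => y e + u e) = joinBits S x y + u := by
  funext e
  simp only [joinBits, Pi.add_apply]
  split_ifs <;> rfl

/-- The kernel of the reduced density operator of the qubits in `S`. -/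
noncomputable def reducedKernel {E : Type} [Fintype E] (S : Finset E) (ψ : QState E)
    (x x' : {e // e ∈ S} → ZMod 2) : ℂ :=
  ∑ y, ψ (joinBits S x y) * conj (ψ (joinBits S x' y))

/-- This form turns a quadratic expression in `ψ` into a linear one in its kernel; the pair `p` will
be read as one bitstring on the two copies. -/
lemma partialProb_eq_sum {E : Type} [Fintype E] (S : Finset E) (ψ : QState E)
    (φ : {e // e ∈ S} → Qubit) :
    (partialProb S ψ φ : ℂ) = ∑ p : ({e // e ∈ S} → ZMod 2) × ({e // e ∈ S} → ZMod 2),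
      conj (productState φ p.1) * productState φ p.2 * reducedKernel S ψ p.1 p.2 := by
  simp only [partialProb, reducedKernel, Complex.ofReal_sum, Finset.mul_sum]
  rw [Finset.sum_comm]
  refine Finset.sum_congr rfl fun y _ => ?_
  rw [Complex.ofReal_pow, ← Complex.mul_conj', Fintype.sum_prod_type, partialBraket, map_sum,
    Finset.sum_mul_sum]
  refine Finset.sum_congr rfl fun x _ => Finset.sum_congr rfl fun x' _ => ?_
  simp only [map_mul, Complex.conj_conj]
  ring

/-! ### Representing the kernel by a code state of another graph. -/

namespace EmbeddedGraph

variable {V E V' E' : Type} [Fintype E] [Fintype E']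

/-- The reduced kernel of a code state is invariant under pairs of boundaries that agree outside
of the measured set. -/
lemma reducedKernel_add (G : EmbeddedGraph V E) {S : Finset E} {ψ : QState E}
    (hψ : ψ ∈ G.codeSpace) {u u' : E → ZMod 2} (hu : u ∈ G.boundaries) (hu' : u' ∈ G.boundaries)
    (h : ∀ e ∉ S, u e = u' e) (x x' : {e // e ∈ S} → ZMod 2) :
    reducedKernel S ψ (fun e => x e + u e) (fun e => x' e + u' e) = reducedKernel S ψ x x' := by
  unfold reducedKernel
  -- Shifting the summation variable by the common outer part of `u` and `u'` completes both shifts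
  -- to full boundaries, under which `ψ` is invariant.
  rw [← Equiv.sum_comp (Equiv.addRight fun e : {e // e ∉ S} => u e)]
  refine Finset.sum_congr rfl fun y _ => ?_
  have h1 : (Equiv.addRight fun e : {e // e ∉ S} => u e) y = fun e => y e + u e := rfl
  have h2 : (fun e : {e // e ∉ S} => y e + u e) = fun e => y e + u' e :=
    funext fun e => by rw [h e.1 e.2]
  rw [h1, joinBits_add, h2, joinBits_add, (G.mem_codeSpace_iff.mp hψ).2 u hu,
    (G.mem_codeSpace_iff.mp hψ).2 u' hu']

/-- An embedded graph with labelled edges represents the partial measurements of the code of `G`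
in `S` if its cycles that avoid the edges labelled `zero` are the pairs of partial cycles of `G`
with a common completion, and if homologous such cycles stem from homologous cycles of `G`. -/
structure Represents (G : EmbeddedGraph V E) (S : Finset E) (G' : EmbeddedGraph V' E')
    (lab : E' → EdgeLabel {e // e ∈ S}) (i₁ i₂ : {e // e ∈ S} → E') : Prop where
  lab_fst : ∀ e e', lab e' = .fst e ↔ e' = i₁ e
  lab_snd : ∀ e e', lab e' = .snd e ↔ e' = i₂ e
  eq_zero : ∀ z ∈ G'.cycles, (∀ e', lab e' = .zero → z e' = 0) → (∀ e, z (i₁ e) = 0) →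
    (∀ e, z (i₂ e) = 0) → z = 0
  exists_cycle : ∀ w ∈ G.cycles, ∀ w' ∈ G.cycles, (∀ e ∉ S, w e = w' e) →
    ∃ z ∈ G'.cycles, (∀ e', lab e' = .zero → z e' = 0) ∧ (∀ e, z (i₁ e) = w e) ∧
      ∀ e, z (i₂ e) = w' e
  exists_boundary : ∀ z ∈ G'.cycles, z ∈ G'.boundaries → (∀ e', lab e' = .zero → z e' = 0) →
    ∃ u ∈ G.boundaries, ∃ u' ∈ G.boundaries, (∀ e ∉ S, u e = u' e) ∧
      (∀ e : {e // e ∈ S}, u e = z (i₁ e)) ∧ ∀ e : {e // e ∈ S}, u' e = z (i₂ e)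

variable {G : EmbeddedGraph V E} {S : Finset E} {G' : EmbeddedGraph V' E'}
  {lab : E' → EdgeLabel {e // e ∈ S}} {i₁ i₂ : {e // e ∈ S} → E'}

/-- The amplitude that the edges labelled `plus` contribute to every outcome. -/
noncomputable def plusFactor {A : Type} (lab : E' → EdgeLabel A) : ℂ :=
  ∏ e', if lab e' = .plus then ((Real.sqrt 2)⁻¹ : ℝ) else (1 : ℝ)

lemma plusFactor_ne_zero {A : Type} (lab : E' → EdgeLabel A) : plusFactor lab ≠ 0 := by
  refine Finset.prod_ne_zero_iff.mpr fun e' _ => ?_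
  split_ifs <;> simp

/-- The second copy carries the conjugate vector, so the conjugation in the bra leaves `φ` itself
there. This matches the two factors in `partialProb_eq_sum`. -/
lemma Represents.conj_productState (h : Represents G S G' lab i₁ i₂)
    (φ : {e // e ∈ S} → Qubit) {z : E' → ZMod 2} (hz : ∀ e', lab e' = .zero → z e' = 0) :
    conj (productState (fun e => (lab e).qubit φ) z) =
      plusFactor lab * (conj (productState φ fun e => z (i₁ e)) *
        productState φ fun e => z (i₂ e)) := by
  have h1 : Function.Injective i₁ := fun a b hab => by
    have h0 := (h.lab_fst a (i₁ a)).mpr rfl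
    rw [hab, (h.lab_fst b _).mpr rfl] at h0
    exact EdgeLabel.fst.inj h0.symm
  have h2 : Function.Injective i₂ := fun a b hab => by
    have h0 := (h.lab_snd a (i₂ a)).mpr rfl
    rw [hab, (h.lab_snd b _).mpr rfl] at h0
    exact EdgeLabel.snd.inj h0.symm
  have h3 : ∏ e, conj (φ e (z (i₁ e))) =
      ∏ e', (match lab e' with | .fst e => conj (φ e (z e')) | _ => 1) := by
    refine Fintype.prod_of_injective i₁ h1 _ _ (fun e' he' => ?_) fun e => ?_
    · split
      · next e hl => exact absurd ⟨e, ((h.lab_fst e e').mp hl).symm⟩ he'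
      · rfl
    · rw [(h.lab_fst e _).mpr rfl]
  have h4 : ∏ e, φ e (z (i₂ e)) =
      ∏ e', (match lab e' with | .snd e => φ e (z e') | _ => 1) := by
    refine Fintype.prod_of_injective i₂ h2 _ _ (fun e' he' => ?_) fun e => ?_
    · split
      · next e hl => exact absurd ⟨e, ((h.lab_snd e e').mp hl).symm⟩ he'
      · rfl
    · rw [(h.lab_snd e _).mpr rfl]
  simp only [productState, map_prod, plusFactor]
  rw [h3, h4, ← Finset.prod_mul_distrib, ← Finset.prod_mul_distrib]
  refine Finset.prod_congr rfl fun e' _ => ?_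
  rcases hl : lab e' with e | e | _ | _
  · simp [EdgeLabel.qubit]
  · simp [EdgeLabel.qubit]
  · simp [EdgeLabel.qubit, hz e' hl]
  · simp [EdgeLabel.qubit]

/-- The value of `T` at a chosen element that satisfies `p`, or `0` if there is none. -/
noncomputable def evalChosen {α : Type} (p : α → Prop) (T : α → ℂ) : ℂ :=
  if h : ∃ a, p a then T h.choose else 0

/-- The code state of the representing graph. -/
noncomputable def representingState (G' : EmbeddedGraph V' E') (lab : E' → EdgeLabel {e // e ∈ S})
    (i₁ i₂ : {e // e ∈ S} → E') (ψ : QState E) : QState E' := fun z =>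
  evalChosen
    (fun z₀ => z₀ ∈ G'.cycles ∧ (∀ e', lab e' = .zero → z₀ e' = 0) ∧ z - z₀ ∈ G'.boundaries)
    fun z₀ => reducedKernel S ψ (fun e => z₀ (i₁ e)) fun e => z₀ (i₂ e)

lemma representingState_mem (ψ : QState E) :
    representingState G' lab i₁ i₂ ψ ∈ G'.codeSpace := by
  refine G'.mem_codeSpace_iff.mpr ⟨fun z hz => ?_, fun b hb z => ?_⟩
  · unfold representingState evalChosen at hz
    split_ifs at hz with h
    · obtain ⟨z₀, h1, -, h2⟩ := h
      simpa using G'.cycles.add_mem (G'.boundaries_le_cycles h2) h1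
    · exact absurd rfl hz
  · have h : ∀ z₀, z + b - z₀ ∈ G'.boundaries ↔ z - z₀ ∈ G'.boundaries := fun z₀ => by
      rw [add_sub_right_comm, G'.boundaries.add_mem_cancel_right hb]
    -- The predicate from which the representative is chosen is the same for `z + b` and `z`, hence
    -- so is the choice.
    simp only [representingState, h]

/-- The chosen representative differs from `z` by a boundary that avoids the `zero` edges. By
`exists_boundary` this is a pair of boundaries of `G` with equal outer parts, which the kernel does
not see. -/
lemma Represents.representingState_eq (h : Represents G S G' lab i₁ i₂) {ψ : QState E}
    (hψ : ψ ∈ G.codeSpace) {z : E' → ZMod 2} (hz : z ∈ G'.cycles)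
    (hz0 : ∀ e', lab e' = .zero → z e' = 0) :
    representingState G' lab i₁ i₂ ψ z =
      reducedKernel S ψ (fun e => z (i₁ e)) fun e => z (i₂ e) := by
  have hex : ∃ z₀ ∈ G'.cycles, (∀ e', lab e' = .zero → z₀ e' = 0) ∧ z - z₀ ∈ G'.boundaries :=
    ⟨z, hz, hz0, by simp [G'.boundaries.zero_mem]⟩
  rw [representingState, evalChosen, dif_pos hex]
  obtain ⟨h1, h2, h3⟩ := hex.choose_spec
  generalize hex.choose = z₀ at h1 h2 h3
  obtain ⟨u, hu, u', hu', h4, h5, h6⟩ := h.exists_boundary _ (G'.cycles.sub_mem hz h1) h3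
    fun e' he' => by simp [hz0 e' he', h2 e' he']
  rw [← G.reducedKernel_add hψ hu hu' h4]
  simp [h5, h6]

/-- Restriction to the two copies is injective on the contributing cycles by `eq_zero`, and reaches
every pair with nonzero kernel by `exists_cycle`. The two sums therefore agree term by term. -/
lemma Represents.braket_representingState (h : Represents G S G' lab i₁ i₂) {ψ : QState E}
    (hψ : ψ ∈ G.codeSpace) (φ : {e // e ∈ S} → Qubit) :
    braket (productState fun e => (lab e).qubit φ) (representingState G' lab i₁ i₂ ψ) =
      plusFactor lab * partialProb S ψ φ := by
  rw [partialProb_eq_sum, Finset.mul_sum, braket,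
    ← Finset.sum_filter_of_ne (p := fun z => z ∈ G'.cycles ∧ ∀ e', lab e' = .zero → z e' = 0)]
  · refine Finset.sum_of_injOn (fun z => (fun e => z (i₁ e), fun e => z (i₂ e))) ?_ ?_ ?_ ?_
    · intro z hz w hw hzw
      simp only [Finset.coe_filter, Finset.mem_univ, true_and, Set.mem_ofPred_eq] at hz hw
      obtain ⟨h1, h2⟩ := Prod.mk.inj hzw
      refine sub_eq_zero.mp (h.eq_zero _ (G'.cycles.sub_mem hz.1 hw.1) (fun e' he' => ?_)
        (fun e => ?_) fun e => ?_)
      · simp [hz.2 e' he', hw.2 e' he']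
      · simpa [sub_eq_zero] using congrFun h1 e
      · simpa [sub_eq_zero] using congrFun h2 e
    · exact fun z _ => Finset.mem_coe.mpr (Finset.mem_univ _)
    · rintro ⟨x, x'⟩ - hx
      by_contra hne
      apply hx
      have h1 : reducedKernel S ψ x x' ≠ 0 := fun h0 => hne (by simp [h0])
      -- A nonzero kernel entry supplies a common completion `y` of both strings to cycles.
      obtain ⟨y, -, hy⟩ := Finset.exists_ne_zero_of_sum_ne_zero h1
      have h2 := (G.mem_codeSpace_iff.mp hψ).1 _ (left_ne_zero_of_mul hy)
      have h3 := (G.mem_codeSpace_iff.mp hψ).1 _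
        ((map_ne_zero _).mp (right_ne_zero_of_mul hy))
      obtain ⟨z, hz, hz0, hz1, hz2⟩ := h.exists_cycle _ h2 _ h3 fun e he => by
        rw [joinBits_of_notMem x y ⟨e, he⟩, joinBits_of_notMem x' y ⟨e, he⟩]
      refine ⟨z, by simpa using ⟨hz, hz0⟩, Prod.ext (funext fun e => ?_) (funext fun e => ?_)⟩
      · exact (hz1 e).trans (joinBits_of_mem _ _ _)
      · exact (hz2 e).trans (joinBits_of_mem _ _ _)
    · intro z hz
      simp only [Finset.mem_filter, Finset.mem_univ, true_and] at hz
      rw [h.conj_productState φ hz.2, h.representingState_eq hψ hz.1 hz.2]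
      ring
  · intro z _ hz
    refine ⟨(G'.mem_codeSpace_iff.mp (representingState_mem ψ)).1 z (right_ne_zero_of_mul hz),
      fun e' he' => ?_⟩
    have h1 := Finset.prod_ne_zero_iff.mp ((map_ne_zero _).mp (left_ne_zero_of_mul hz)) e'
      (Finset.mem_univ _)
    simp only [he'] at h1
    by_contra h2
    exact h1 (if_neg h2)

/-- The code space is linear, so both the constant from the `plus` edges and the prescribed `α` are
removed by rescaling. -/
lemma Represents.exists_state (h : Represents G S G' lab i₁ i₂) {ψ : QState E}
    (hψ : ψ ∈ G.codeSpace) {α : ℂ} (hα : α ≠ 0) :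
    ∃ ψ' ∈ G'.codeSpace, ∀ φ : {e // e ∈ S} → Qubit, (partialProb S ψ φ : ℂ) =
      α * braket (productState fun e => (lab e).qubit φ) ψ' := by
  refine ⟨(α * plusFactor lab)⁻¹ • representingState G' lab i₁ i₂ ψ,
    G'.codeSpace.smul_mem _ (representingState_mem ψ), fun φ => ?_⟩
  have h1 := h.braket_representingState hψ φ
  have h2 := plusFactor_ne_zero lab
  have h3 : braket (productState fun e => (lab e).qubit φ)
      ((α * plusFactor lab)⁻¹ • representingState G' lab i₁ i₂ ψ) =
      (α * plusFactor lab)⁻¹ * braket (productState fun e => (lab e).qubit φ)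
        (representingState G' lab i₁ i₂ ψ) := by
    simp only [braket, Finset.mul_sum, Pi.smul_apply, smul_eq_mul]
    exact Finset.sum_congr rfl fun z _ => by ring
  rw [h3, h1]
  field_simp

end EmbeddedGraph

/-! ### Edge additions and vertex splittings, read backwards as deletions and contractions. -/

namespace LabelledGraph

variable {A : Type}

/-- Contracting a rooted forest of edges labelled `plus` and deleting edges labelled `zero` turns
`K` into `H`. Here `f` contracts the vertices, `s` sends a vertex to the root of its tree, `h` embeds
the edges, and `par w` is the other end of the edge `pe w` that joins `w` to its parent. -/
structure IsContraction (H K : LabelledGraph A) (f : K.V → H.V) (s : H.V → K.V) (h : H.E → K.E)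
    (rank : K.V → ℕ) (par : K.V → K.V) (pe : {w // s (f w) ≠ w} → K.E) : Prop where
  f_s : ∀ v, f (s v) = v
  h_inj : Function.Injective h
  lab_h : ∀ e, K.lab (h e) = H.lab e
  ends_h : ∀ e, (K.ends (h e)).map f = H.ends e
  pe_inj : Function.Injective pe
  lab_pe : ∀ w, K.lab (pe w) = .plus
  ends_pe : ∀ w, K.ends (pe w) = s(w.1, par w)
  rank_par : ∀ w, s (f w) ≠ w → rank (par w) < rank w
  f_par : ∀ w, s (f w) ≠ w → f (par w) = f w
  pe_ne_h : ∀ w e, pe w ≠ h e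
  other : ∀ e, (∃ e', h e' = e) ∨ K.lab e = .zero ∨ ∃ w, pe w = e

/-- Deletion of an edge. -/
def deleteEdge (K : LabelledGraph A) (e : K.E) : LabelledGraph A where
  V := K.V
  E := {e' // e' ≠ e}
  ends e' := K.ends e'
  lab e' := K.lab e'

lemma expands_of_deleteEdge {H K : LabelledGraph A} {e : K.E} (he : K.lab e = .zero)
    (h : H.Expands (K.deleteEdge e)) : H.Expands K := by
  obtain ⟨u, v, huv⟩ : ∃ u v, K.ends e = s(u, v) := by
    induction K.ends e with | _ u v => exact ⟨u, v, rfl⟩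
  refine (h.tail (Step.addEdge (K.deleteEdge e) u v)).tail
    (Step.iso _ _ (Equiv.refl K.V) (Equiv.optionSubtypeNe e) ?_ ?_)
  · rintro (_ | e')
    · exact (congrArg K.ends (Equiv.optionSubtypeNe_none e)).trans huv
    · exact (congrArg K.ends (Equiv.optionSubtypeNe_some e e')).trans
        (congrFun Sym2.map_id _).symm
  · rintro (_ | e')
    · exact (congrArg K.lab (Equiv.optionSubtypeNe_none e)).trans he
    · exact congrArg K.lab (Equiv.optionSubtypeNe_some e e')

/-- Contraction of an edge by replacing its end `w` with its other end `u`. -/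
noncomputable def contractEdge (K : LabelledGraph A) (w u : K.V) (hu : u ≠ w) (e : K.E) :
    LabelledGraph A where
  V := {v // v ≠ w}
  E := {e' // e' ≠ e}
  ends e' := (K.ends e').map fun v => if h : v = w then ⟨u, hu⟩ else ⟨v, h⟩
  lab e' := K.lab e'

lemma expands_of_contractEdge {H K : LabelledGraph A} {w u : K.V} {hu : u ≠ w} {e : K.E}
    (he : K.lab e = .plus) (hends : K.ends e = s(w, u))
    (h : H.Expands (K.contractEdge w u hu e)) : H.Expands K := by
  refine (h.tail (Step.splitVertex (K.contractEdge w u hu e) ⟨u, hu⟩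
    (fun e' : {e' // e' ≠ e} => (K.ends e'.1).map (Equiv.optionSubtypeNe w).symm)
    fun e' => ?_)).tail
    (Step.iso _ _ (Equiv.optionSubtypeNe w) (Equiv.optionSubtypeNe e) ?_ ?_)
  · refine (Sym2.map_map (K.ends e'.1)).trans (Sym2.map_congr fun v _ => ?_)
    change ((Equiv.optionSubtypeNe w).symm v).getD (⟨u, hu⟩ : {v // v ≠ w}) = _
    by_cases hv : v = w
    · simp [hv]
    · simp [hv, Equiv.optionSubtypeNe_symm_of_ne hv]
  · rintro (_ | e')
    · refine (congrArg K.ends (Equiv.optionSubtypeNe_none e)).trans (hends.trans ?_)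
      refine Sym2.eq_swap.trans ?_
      change _ = s(Equiv.optionSubtypeNe w (some ⟨u, hu⟩), Equiv.optionSubtypeNe w none)
      simp
    · refine (congrArg K.ends (Equiv.optionSubtypeNe_some e e')).trans ?_
      change _ = ((K.ends e'.1).map (Equiv.optionSubtypeNe w).symm).map (Equiv.optionSubtypeNe w)
      rw [Sym2.map_map, Equiv.self_comp_symm, Sym2.map_id, id]
  · rintro (_ | e')
    · exact (congrArg K.lab (Equiv.optionSubtypeNe_none e)).trans he
    · exact congrArg K.lab (Equiv.optionSubtypeNe_some e e')

/-- Induction on the number of edges. Removing a `zero` edge undoes an addition and contracting a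
parent edge undoes a splitting; either way the remaining graph still carries contraction data. Edges
in the image of `h` are never removed, whatever their labels. -/
theorem expands_of_isContraction {H : LabelledGraph A} (n : ℕ) : ∀ {K : LabelledGraph A}
    [Finite K.E] {f : K.V → H.V} {s : H.V → K.V} {h : H.E → K.E} {rank : K.V → ℕ}
    {par : K.V → K.V} {pe : {w // s (f w) ≠ w} → K.E},
    Nat.card K.E = n → H.IsContraction K f s h rank par pe → H.Expands K := by
  induction n using Nat.strong_induction_on with
  | _ n ih =>
    intro K _ f s h rank par pe hn hK
    have hcard : ∀ e : K.E, Nat.card {e' // e' ≠ e} < n := fun e => by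
      rw [← hn]
      exact Finite.card_subtype_lt (x := e) (by simp)
    by_cases h0 : ∃ e, K.lab e = .zero ∧ ∀ e', h e' ≠ e
    · obtain ⟨e, he, hne⟩ := h0
      have : Finite (K.deleteEdge e).E := inferInstanceAs (Finite {e' // e' ≠ e})
      refine expands_of_deleteEdge he (ih _ (hcard e) (K := K.deleteEdge e) (f := f) (s := s)
        (h := fun e' => ⟨h e', hne e'⟩) (rank := rank) (par := par)
        (pe := fun w => ⟨pe w, fun hw => by
          cases (hK.lab_pe w).symm.trans ((congrArg K.lab hw).trans he)⟩) rfl ?_)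
      exact {
        f_s := hK.f_s
        h_inj := fun a b hab => hK.h_inj (congrArg Subtype.val hab)
        lab_h := hK.lab_h
        ends_h := hK.ends_h
        pe_inj := fun a b hab => hK.pe_inj (congrArg Subtype.val hab)
        lab_pe := hK.lab_pe
        ends_pe := hK.ends_pe
        rank_par := hK.rank_par
        f_par := hK.f_par
        pe_ne_h := fun w e' hw => hK.pe_ne_h w e' (congrArg Subtype.val hw)
        other := fun e' => (hK.other e'.1).imp (fun ⟨a, ha⟩ => ⟨a, Subtype.ext ha⟩)
          (Or.imp_right fun ⟨a, ha⟩ => ⟨a, Subtype.ext ha⟩) }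
    by_cases h1 : ∃ w, s (f w) ≠ w
    · obtain ⟨w, hw⟩ := h1
      have hu : par w ≠ w := fun hu => (hu ▸ hK.rank_par w hw).false
      -- The children of `w` are handed to its parent. This keeps `f` and only lowers ranks, so the
      -- rest is again a rooted forest.
      let g : K.V → {v // v ≠ w} := fun v => if h : v = w then ⟨par w, hu⟩ else ⟨v, h⟩
      have hfg : ∀ v, f (g v).1 = f v := fun v => by
        simp only [g]
        split_ifs with hv
        · rw [hv, hK.f_par w hw]
        · rfl
      have hrg : ∀ v, rank (g v).1 ≤ rank v := fun v => by
        simp only [g]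
        split_ifs with hv
        · exact hv ▸ (hK.rank_par w hw).le
        · exact le_rfl
      have hs : ∀ v, s v ≠ w := fun v hv => hw (by rw [← hv, hK.f_s])
      have hsub : ∀ u : {v // v ≠ w}, (⟨s (f u.1), hs _⟩ : {v // v ≠ w}) ≠ u → s (f u.1) ≠ u.1 :=
        fun u hu h' => hu (Subtype.ext h')
      have : Finite (K.contractEdge w (par w) hu (pe ⟨w, hw⟩)).E :=
        inferInstanceAs (Finite {e' // e' ≠ pe ⟨w, hw⟩})
      refine expands_of_contractEdge (hK.lab_pe ⟨w, hw⟩) (hK.ends_pe ⟨w, hw⟩) (hu := hu)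
        (ih _ (hcard (pe ⟨w, hw⟩)) (K := K.contractEdge w (par w) hu (pe ⟨w, hw⟩))
          (f := fun v => f v.1) (s := fun v => ⟨s v, hs v⟩)
          (h := fun e' => ⟨h e', (hK.pe_ne_h _ _).symm⟩) (rank := fun v => rank v.1)
          (par := fun v => g (par v.1))
          (pe := fun v => ⟨pe ⟨v.1.1, hsub v.1 v.2⟩, fun hv => v.1.2
            (congrArg Subtype.val (hK.pe_inj hv))⟩) rfl ?_)
      exact {
        f_s := hK.f_s
        h_inj := fun a b hab => hK.h_inj (congrArg Subtype.val hab)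
        lab_h := hK.lab_h
        ends_h := fun e => by
          rw [← hK.ends_h]
          exact (Sym2.map_map (K.ends (h e))).trans (Sym2.map_congr fun v _ => hfg v)
        pe_inj := fun a b hab => Subtype.ext (Subtype.ext (congrArg
          (fun v : {w // s (f w) ≠ w} => v.1) (hK.pe_inj (congrArg Subtype.val hab))))
        lab_pe := fun v => hK.lab_pe _
        ends_pe := fun v => by
          have hv : g v.1.1 = v.1 := dif_neg v.1.2
          refine (congrArg (Sym2.map g) (hK.ends_pe ⟨v.1.1, hsub v.1 v.2⟩)).trans ?_
          exact congrArg (fun u => s(u, g (par v.1.1))) hv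
        rank_par := fun v hv => (hrg _).trans_lt (hK.rank_par v.1 (hsub v hv))
        f_par := fun v hv => (hfg _).trans (hK.f_par v.1 (hsub v hv))
        pe_ne_h := fun w e' hw => hK.pe_ne_h _ e' (congrArg Subtype.val hw)
        other := fun e' => (hK.other e'.1).imp (fun ⟨a, ha⟩ => ⟨a, Subtype.ext ha⟩)
          (Or.imp_right fun ⟨a, ha⟩ => ⟨⟨⟨a.1, fun haw => e'.2 (by
            rw [← ha]; exact congrArg pe (Subtype.ext haw))⟩,
            fun h' => a.2 (congrArg Subtype.val h')⟩, Subtype.ext ha⟩) }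
    -- With nothing left to delete or contract, `s` inverts `f` and `h` is onto, so the two graphs
    -- are isomorphic.
    · push Not at h0 h1
      refine Relation.ReflTransGen.single (Step.iso _ _
        ⟨s, f, hK.f_s, h1⟩ (Equiv.ofBijective h ⟨hK.h_inj, fun e => ?_⟩) (fun e => ?_)
        hK.lab_h)
      · rcases hK.other e with he | he | ⟨w, -⟩
        · exact he
        · exact h0 e he
        · exact absurd (h1 w.1) w.2
      · rw [← hK.ends_h, Sym2.map_map]
        change K.ends (h e) = _
        refine (congrFun Sym2.map_id (K.ends (h e))).symm.trans (Sym2.map_congr fun v _ => ?_)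
        exact (h1 v).symm

end LabelledGraph

/-! ### Cycles and boundaries of a punctured cylinder in coordinates. -/

namespace PuncturedCylinder

variable (P : PuncturedCylinder)

/-- The bit of the vertical edge that leaves row `i` downwards in column `c`. -/
def vertBit (z : P.Edge → ZMod 2) (i : Fin P.N) (c : ℕ) : ZMod 2 :=
  if h : c < P.M then z (.inl (i, ⟨c, h⟩)) else 0

/-- The bit of the horizontal edge in row `i` to the right of column `c`. -/
def horBit (z : P.Edge → ZMod 2) (i : Fin P.N) (c : ℕ) : ZMod 2 :=
  if h : c < P.M - 1 then z (.inr (i, ⟨c, h⟩)) else 0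

/-- The terms are the down, up, right and left edges. `horBit` vanishes by default past the last
column; the left term needs its guard because `0 - 1 = 0` in `ℕ`. -/
lemma mem_cycles_iff (z : P.Edge → ZMod 2) : z ∈ P.graph.cycles ↔ ∀ i c, c < P.M →
    P.vertBit z i c + P.vertBit z ((P.below c).symm i) c + P.horBit z i c +
      (if c = 0 then 0 else P.horBit z i (c - 1)) = 0 := by
  have key : ∀ (i : Fin P.N) (c : Fin P.M), ∑ e ∈ P.graph.star (i, c), z e =
      P.vertBit z i c + P.vertBit z ((P.below c).symm i) c + P.horBit z i c +
      (if c.1 = 0 then 0 else P.horBit z i (c.1 - 1)) := by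
    intro i c
    rw [P.graph.sum_star, Fintype.sum_prod_type]
    simp only [Fintype.sum_bool, Finset.sum_add_distrib, Fintype.sum_sum_type]
    have h1 : ∑ p : Fin P.N × Fin P.M, (if P.graph.src (.inl p, false) = (i, c) then
        z (.inl p) else 0) = P.vertBit z i c := by
      rw [Finset.sum_eq_single (i, c)]
      · simp [vertBit, graph, src]
      · rintro ⟨i', c'⟩ - hne
        exact if_neg hne
      · simp
    have h2 : ∑ p : Fin P.N × Fin P.M, (if P.graph.src (.inl p, true) = (i, c) then
        z (.inl p) else 0) = P.vertBit z ((P.below c).symm i) c := by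
      rw [Finset.sum_eq_single ((P.below c).symm i, c)]
      · simp [vertBit, graph, src]
      · rintro ⟨i', c'⟩ - hne
        refine if_neg fun h => hne ?_
        obtain ⟨hi, hc⟩ := Prod.mk.inj h
        subst hc
        exact Prod.ext ((Equiv.eq_symm_apply _).mpr hi) rfl
      · simp
    have h3 : ∑ p : Fin P.N × Fin (P.M - 1), (if P.graph.src (.inr p, false) = (i, c) then
        z (.inr p) else 0) = P.horBit z i c := by
      by_cases hc : c.1 < P.M - 1
      · rw [Finset.sum_eq_single (i, ⟨c.1, hc⟩)]
        · simp [horBit, graph, src, hc]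
        · rintro ⟨i', c'⟩ - hne
          refine if_neg fun h => hne ?_
          obtain ⟨rfl, rfl⟩ := Prod.mk.inj h
          rfl
        · simp
      · rw [horBit, dif_neg hc]
        refine Finset.sum_eq_zero ?_
        rintro ⟨i', c'⟩ -
        refine if_neg fun h => hc ?_
        obtain ⟨rfl, rfl⟩ := Prod.mk.inj h
        exact c'.2
    have h4 : ∑ p : Fin P.N × Fin (P.M - 1), (if P.graph.src (.inr p, true) = (i, c) then
        z (.inr p) else 0) = if c.1 = 0 then 0 else P.horBit z i (c.1 - 1) := by
      by_cases hc : c.1 = 0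
      · rw [if_pos hc]
        refine Finset.sum_eq_zero ?_
        rintro ⟨i', c'⟩ -
        refine if_neg fun h => ?_
        obtain ⟨rfl, rfl⟩ := Prod.mk.inj h
        simp at hc
      · have hc' : c.1 - 1 < P.M - 1 := by omega
        rw [if_neg hc, horBit, dif_pos hc', Finset.sum_eq_single (i, ⟨c.1 - 1, hc'⟩)]
        · refine if_pos (Prod.ext (by rfl) (Fin.ext ?_))
          change c.1 - 1 + 1 = c.1
          omega
        · rintro ⟨i', c'⟩ - hne
          refine if_neg fun h => hne ?_
          obtain ⟨rfl, rfl⟩ := Prod.mk.inj h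
          rfl
        · simp
    rw [h1, h2, h3, h4]
    ring
  rw [EmbeddedGraph.mem_cycles]
  constructor
  · intro h i c hc
    exact (key i ⟨c, hc⟩).symm.trans (h _)
  · rintro h ⟨i, c⟩
    exact (key i c).trans (h i c.1 c.2)

/-- `s g i` is the bit of the face that contains the right side of the vertical edge below row `i`
of column `g - 1` or the left side of the one of column `g`. -/
def IsFaceSet (s : ℕ → Fin P.N → ZMod 2) : Prop :=
  (∀ c, c + 1 < P.M → ∀ i,
    s (c + 1) ((P.below c).symm i) = s (c + 1) ((P.below (c + 1)).symm i)) ∧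
  (∀ i, s 0 ((P.below 0).symm i) = s 0 i) ∧
  ∀ i, s P.M ((P.below (P.M - 1)).symm i) = s P.M i

/-- The boundary of a set of faces. -/
def bdryOf (s : ℕ → Fin P.N → ZMod 2) : P.Edge → ZMod 2
  | .inl (i, c) => s c i + s (c + 1) i
  | .inr (i, c) => s (c + 1) i + s (c + 1) ((P.below c).symm i)

/-- Each dart receives the bit of the face on its left. The three conditions of `IsFaceSet` are the
face steps that this assignment does not respect automatically: across a gap whose two columns may
be cut differently, and around the two end caps. -/
lemma bdryOf_mem_boundaries {s : ℕ → Fin P.N → ZMod 2} (hs : P.IsFaceSet s) :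
    P.bdryOf s ∈ P.graph.boundaries := by
  obtain ⟨h1, h2, h3⟩ := hs
  let σ : P.Edge × Bool → ZMod 2 := fun
    | (.inl (i, c), true) => s c i
    | (.inl (i, c), false) => s (c + 1) i
    | (.inr (i, c), true) => s (c + 1) i
    | (.inr (i, c), false) => s (c + 1) ((P.below c).symm i)
  refine ⟨σ, ?_, ?_⟩
  · intro d
    change σ (P.rotFun (d.1, !d.2)) = σ d
    rcases d with ⟨⟨i, c⟩ | ⟨i, c⟩, _ | _⟩
    · simp only [Bool.not_false, rotFun]
      split_ifs with hc
      · simp [σ]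
      · have hM : c.1 + 1 = P.M := by omega
        have hM' : c.1 = P.M - 1 := by omega
        have := h3 (P.below c.1 i)
        rw [← hM', Equiv.symm_apply_apply] at this
        simp only [σ, hM]
        exact this.symm
    · simp only [Bool.not_true, rotFun]
      split_ifs with hc
      · have : c.1 - 1 + 1 = c.1 := by omega
        simp [σ, this]
      · have h0 : c.1 = 0 := by omega
        have := h2 i
        simp only [σ, h0]
        exact this
    · have := c.2
      exact (h1 c.1 (by omega) i).symm
    · rfl
  · rintro (⟨i, c⟩ | ⟨i, c⟩)
    · exact add_comm _ _
    · exact add_comm _ _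

lemma exists_eq_bdryOf {z : P.Edge → ZMod 2} (hz : z ∈ P.graph.boundaries) :
    ∃ s, P.IsFaceSet s ∧ z = P.bdryOf s := by
  obtain ⟨σ, h1, h2⟩ := hz
  have hM := P.columns
  -- Gap `g` is read off from the left sides of column `g`; the last gap has no such column and is
  -- read off from the right sides of column `M - 1`.
  let s : ℕ → Fin P.N → ZMod 2 := fun g i =>
    if h : g < P.M then σ (.inl (i, ⟨g, h⟩), true) else σ (.inl (i, ⟨P.M - 1, by omega⟩), false)
  have step : ∀ d, σ (P.rotFun (d.1, !d.2)) = σ d := h1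
  have hl : ∀ i (c : Fin P.M), σ (.inl (i, c), true) = s c i := fun i c => by simp [s]
  have hrt : ∀ i (c : Fin (P.M - 1)), σ (.inr (i, c), true) = s (c + 1) i := fun i c => by
    have hc : c.1 + 1 < P.M := by have := c.2; omega
    have := step (.inl (i, ⟨c.1 + 1, hc⟩), true)
    simp only [Bool.not_true, rotFun, Nat.succ_pos, dif_pos, Nat.add_sub_cancel] at this
    rw [this, hl]
  have hr : ∀ i (c : Fin P.M), σ (.inl (i, c), false) = s (c + 1) i := fun i c => by
    by_cases hc : c.1 + 1 < P.M
    · have := step (.inr (i, ⟨c.1, by omega⟩), true)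
      simp only [Bool.not_true, rotFun] at this
      rw [this, hrt]
    · have : c = ⟨P.M - 1, by omega⟩ := Fin.ext (by have := c.2; simp only; omega)
      simp only [s, dif_neg hc]
      rw [this]
  have hrf : ∀ i (c : Fin (P.M - 1)), σ (.inr (i, c), false) =
      s (c + 1) ((P.below (c + 1)).symm i) := fun i c => by
    rw [← step]
    simp only [Bool.not_false, rotFun]
    rw [hl]
  have hrf' : ∀ i (c : Fin (P.M - 1)), σ (.inr (i, c), false) =
      s (c + 1) ((P.below c).symm i) := fun i c => by
    have hc : c.1 + 1 < P.M := by have := c.2; omega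
    have := step (.inl ((P.below c).symm i, ⟨c.1, by omega⟩), false)
    simp only [Bool.not_false, rotFun, hc, dif_pos, Equiv.apply_symm_apply] at this
    rw [this, hr]
  refine ⟨s, ⟨fun c hc i => ?_, fun i => ?_, fun i => ?_⟩, ?_⟩
  · exact (hrf' i ⟨c, by omega⟩).symm.trans (hrf i ⟨c, by omega⟩)
  · have := step (.inl (i, ⟨0, hM⟩), true)
    simp only [Bool.not_true, rotFun, lt_irrefl, dif_neg, not_false_eq_true] at this
    rw [hl, hl] at this
    exact this
  · have hlast : ¬ (P.M - 1 + 1 < P.M) := by omega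
    have := step (.inl ((P.below (P.M - 1)).symm i, ⟨P.M - 1, by omega⟩), false)
    simp only [Bool.not_false, rotFun, hlast, dif_neg, not_false_eq_true,
      Equiv.apply_symm_apply] at this
    rw [hr, hr] at this
    have hM' : P.M - 1 + 1 = P.M := by omega
    simp only [hM'] at this
    exact this.symm
  · funext e
    rw [h2]
    rcases e with ⟨i, c⟩ | ⟨i, c⟩
    · rw [hl, hr, add_comm]
      rfl
    · rw [hrt, hrf', add_comm]
      rfl

end PuncturedCylinder

/-! ### Mirroring a punctured cylinder in a column. -/

namespace PuncturedCylinder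

variable (P : PuncturedCylinder)

lemma slots_trichotomy {s s' : Slot} (hs : s ∈ P.slots) (hs' : s' ∈ P.slots) : s = s' ∨
    (s.x + s.K ≤ s'.x ∧ (s.x + s.K = s'.x → s.y ≠ s'.y)) ∨
    (s'.x + s'.K ≤ s.x ∧ (s'.x + s'.K = s.x → s'.y ≠ s.y)) := by
  let S : Slot → Slot → Prop := fun s s' =>
    (s.x + s.K ≤ s'.x ∧ (s.x + s.K = s'.x → s.y ≠ s'.y)) ∨
    (s'.x + s'.K ≤ s.x ∧ (s'.x + s'.K = s.x → s'.y ≠ s.y))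
  have : Std.Symm S := ⟨fun _ _ => Or.symm⟩
  have h : P.slots.Pairwise S := P.slot_order.imp fun h => Or.inl h
  by_cases hne : s = s'
  · exact Or.inl hne
  · exact Or.inr (h.forall hs hs' hne)

/-- The column ranges of distinct slots are disjoint, so the search in `cut` can only find `s`. -/
lemma cut_eq_of_mem {s : Slot} (hs : s ∈ P.slots) {c : ℕ} (h1 : s.x ≤ c) (h2 : c < s.x + s.K) :
    P.cut c = s.y := by
  unfold cut
  split
  · next s' hs' =>
    have h3 := List.mem_of_find?_eq_some hs'
    have h4 := List.find?_some hs'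
    simp only [decide_eq_true_eq] at h4
    rcases P.slots_trichotomy hs h3 with rfl | h | h
    · rfl
    · omega
    · omega
  · next hs' =>
    have := List.find?_eq_none.mp hs' s hs
    simp at this
    omega

lemma cut_eq_zero {c : ℕ} (h : ∀ s ∈ P.slots, s.x ≤ c → ¬ c < s.x + s.K) : P.cut c = 0 := by
  unfold cut
  split
  · next s' hs' =>
    have h3 := List.mem_of_find?_eq_some hs'
    have h4 := List.find?_some hs'
    simp only [decide_eq_true_eq] at h4
    exact absurd h4.2 (h _ h3 h4.1)
  · rfl

/-- The slots entirely to the left of column `k`. -/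
def leftSlots (k : ℕ) : List Slot := P.slots.filter fun s => decide (s.x + s.K ≤ k)

/-- The slot that occupies column `k`, if any, made symmetric about this column. -/
def middleSlots (k : ℕ) : List Slot :=
  (P.slots.filter fun s => decide (s.x ≤ k ∧ k < s.x + s.K)).map
    fun s => ⟨s.x, s.y, 2 * (k - s.x) + 1⟩

/-- The mirror image of a slot with respect to column `k`. -/
def mirrorSlot (k : ℕ) (s : Slot) : Slot := ⟨2 * k + 1 - s.x - s.K, s.y, s.K⟩

lemma mem_leftSlots {k : ℕ} {s : Slot} : s ∈ P.leftSlots k ↔ s ∈ P.slots ∧ s.x + s.K ≤ k := by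
  simp [leftSlots]

lemma mem_middleSlots {k : ℕ} {s : Slot} : s ∈ P.middleSlots k ↔
    ∃ s' ∈ P.slots, s'.x ≤ k ∧ k < s'.x + s'.K ∧ s = ⟨s'.x, s'.y, 2 * (k - s'.x) + 1⟩ := by
  simp only [middleSlots, List.mem_map, List.mem_filter, decide_eq_true_eq]
  constructor
  · rintro ⟨s', ⟨h1, h2, h3⟩, rfl⟩
    exact ⟨s', h1, h2, h3, rfl⟩
  · rintro ⟨s', h1, h2, h3, rfl⟩
    exact ⟨s', ⟨h1, h2, h3⟩, rfl⟩

lemma mem_mirrorSlots {k : ℕ} {s : Slot} :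
    s ∈ ((P.leftSlots k).map (mirrorSlot k)).reverse ↔
      ∃ s' ∈ P.slots, s'.x + s'.K ≤ k ∧ s = ⟨2 * k + 1 - s'.x - s'.K, s'.y, s'.K⟩ := by
  simp only [List.mem_reverse, List.mem_map, mem_leftSlots, mirrorSlot]
  constructor
  · rintro ⟨s', ⟨h1, h2⟩, rfl⟩
    exact ⟨s', h1, h2, rfl⟩
  · rintro ⟨s', h1, h2, rfl⟩
    exact ⟨s', ⟨h1, h2⟩, rfl⟩

/-- The slots in the columns up to `k` and their mirror images. -/
def mirrorSlots (k : ℕ) : List Slot :=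
  P.leftSlots k ++ P.middleSlots k ++ ((P.leftSlots k).map (mirrorSlot k)).reverse

lemma mem_mirrorSlots_cases {k : ℕ} {s : Slot} (hs : s ∈ P.mirrorSlots k) :
    ∃ s' ∈ P.slots, s.y = s'.y ∧ ((s'.x + s'.K ≤ k ∧ s = s') ∨
      (s'.x ≤ k ∧ k < s'.x + s'.K ∧ s.x = s'.x ∧ s.K = 2 * (k - s'.x) + 1) ∨
      (s'.x + s'.K ≤ k ∧ s.x = 2 * k + 1 - s'.x - s'.K ∧ s.K = s'.K)) := by
  rw [mirrorSlots, List.mem_append, List.mem_append, mem_leftSlots, mem_middleSlots,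
    mem_mirrorSlots] at hs
  rcases hs with (⟨h1, h2⟩ | ⟨s', h1, h2, h3, rfl⟩) | ⟨s', h1, h2, rfl⟩
  · exact ⟨s, h1, rfl, Or.inl ⟨h2, rfl⟩⟩
  · exact ⟨s', h1, rfl, Or.inr (Or.inl ⟨h2, h3, rfl, rfl⟩)⟩
  · exact ⟨s', h1, rfl, Or.inr (Or.inr ⟨h2, rfl, rfl⟩)⟩

/-- Slots that touch in the mirrored list are touching slots of `P` or reflections of them. A left
slot never touches a mirrored one, since column `k` lies between them, and at most one slot occupies
column `k`. -/
lemma mirrorSlots_order (k : ℕ) : (P.mirrorSlots k).Pairwise fun s s' =>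
    s.x + s.K ≤ s'.x ∧ (s.x + s.K = s'.x → s.y ≠ s'.y) := by
  have hl : (P.leftSlots k).Pairwise fun s s' =>
      s.x + s.K ≤ s'.x ∧ (s.x + s.K = s'.x → s.y ≠ s'.y) := P.slot_order.filter _
  rw [mirrorSlots, List.pairwise_append, List.pairwise_append]
  refine ⟨⟨hl, ?_, ?_⟩, ?_, ?_⟩
  · rw [middleSlots, List.pairwise_map]
    refine (P.slot_order.filter _).imp_of_mem fun {s s'} hs hs' h => ?_
    simp only [List.mem_filter, decide_eq_true_eq] at hs hs'
    omega
  · intro s hs s' hs'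
    obtain ⟨h1, h2⟩ := P.mem_leftSlots.mp hs
    obtain ⟨s', h3, h4, h5, rfl⟩ := P.mem_middleSlots.mp hs'
    rcases P.slots_trichotomy h1 h3 with rfl | h | h
    · omega
    · exact h
    · have := P.slot_width s h1
      omega
  · rw [List.pairwise_reverse, List.pairwise_map]
    refine hl.imp_of_mem fun {s s'} hs hs' h => ?_
    have h1 := (P.mem_leftSlots.mp hs).2
    have h2 := (P.mem_leftSlots.mp hs').2
    simp only [mirrorSlot]
    refine ⟨by omega, fun h3 h4 => h.2 (by omega) h4.symm⟩
  · intro s hs s' hs'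
    obtain ⟨s', h3, h4, rfl⟩ := P.mem_mirrorSlots.mp hs'
    rcases List.mem_append.mp hs with hs | hs
    · have := (P.mem_leftSlots.mp hs).2
      refine ⟨?_, fun h => ?_⟩ <;> simp only at * <;> omega
    · obtain ⟨s, h1, h2, h5, rfl⟩ := P.mem_middleSlots.mp hs
      have := P.slot_width s' h3
      rcases P.slots_trichotomy h1 h3 with rfl | h | h
      · omega
      · omega
      · refine ⟨by simp only; omega, fun h6 h7 => h.2 ?_ h7.symm⟩
        simp only at h6
        omega

/-- The columns up to `k` together with their mirror image with respect to column `k`. -/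
abbrev mirror (k : ℕ) : PuncturedCylinder where
  N := P.N
  M := 2 * k + 1
  slots := P.mirrorSlots k
  rows := P.rows
  columns := by omega
  slot_width s hs := by
    obtain ⟨s', h1, -, h⟩ := P.mem_mirrorSlots_cases hs
    have := P.slot_width s' h1
    rcases h with ⟨-, rfl⟩ | h | h <;> omega
  slot_rows s hs := by
    obtain ⟨s', h1, h2, -⟩ := P.mem_mirrorSlots_cases hs
    exact h2 ▸ P.slot_rows s' h1
  slot_columns s hs := by
    obtain ⟨s', h1, -, h⟩ := P.mem_mirrorSlots_cases hs
    have := P.slot_columns s' h1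
    have := P.slot_width s' h1
    rcases h with ⟨h, rfl⟩ | h | h <;> omega
  slot_order := P.mirrorSlots_order k

/-- Slots left of column `k` count twice, one through it once, and all others are dropped. -/
lemma genus_mirror_le (k : ℕ) : (P.mirror k).genus ≤ 2 * P.genus := by
  have h : ∀ l : List Slot, (l.filter fun s => decide (s.x + s.K ≤ k)).length +
      (l.filter fun s => decide (s.x ≤ k ∧ k < s.x + s.K)).length ≤ l.length := by
    intro l
    induction l with
    | nil => simp
    | cons s l ih =>
      simp only [List.filter_cons, decide_eq_true_eq]
      split_ifs <;> simp only [List.length_cons] <;> omega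
  have h1 := h P.slots
  simp only [genus, mirrorSlots, List.length_append, List.length_reverse, List.length_map,
    leftSlots, middleSlots]
  omega

/-- The column that has column `j` as its copy or mirror image. -/
def foldCol (k j : ℕ) : ℕ := if j ≤ k then j else 2 * k - j

/-- The folded column may lie beyond the last column of `P`; `cut` is then `0` on both sides, which
permits mirroring just past the end. -/
lemma cut_mirror {k j : ℕ} (hj : j ≤ 2 * k) : (P.mirror k).cut j = P.cut (foldCol k j) := by
  by_cases h : ∃ s ∈ P.slots, s.x ≤ foldCol k j ∧ foldCol k j < s.x + s.K
  · obtain ⟨s, hs, h1, h2⟩ := h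
    rw [P.cut_eq_of_mem hs h1 h2]
    unfold foldCol at h1 h2
    by_cases hk : k < s.x + s.K
    · have hm : (⟨s.x, s.y, 2 * (k - s.x) + 1⟩ : Slot) ∈ (P.mirror k).slots :=
        List.mem_append_left _ (List.mem_append_right _
          (P.mem_middleSlots.mpr ⟨s, hs, by split_ifs at h1 <;> omega, hk, rfl⟩))
      refine (P.mirror k).cut_eq_of_mem hm ?_ ?_ <;> simp only <;> split_ifs at h1 h2 <;> omega
    · by_cases hjk : j ≤ k
      · rw [if_pos hjk] at h1 h2
        exact (P.mirror k).cut_eq_of_mem (List.mem_append_left _ (List.mem_append_left _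
          (P.mem_leftSlots.mpr ⟨hs, by omega⟩))) h1 h2
      · rw [if_neg hjk] at h1 h2
        have hm : (⟨2 * k + 1 - s.x - s.K, s.y, s.K⟩ : Slot) ∈ (P.mirror k).slots :=
          List.mem_append_right _ (P.mem_mirrorSlots.mpr ⟨s, hs, by omega, rfl⟩)
        refine (P.mirror k).cut_eq_of_mem hm ?_ ?_ <;> simp only <;> omega
  · push Not at h
    rw [P.cut_eq_zero fun s hs h1 => by have := h s hs h1; omega]
    refine (P.mirror k).cut_eq_zero fun s hs h1 h2 => ?_
    obtain ⟨s', hs', -, h3⟩ := P.mem_mirrorSlots_cases hs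
    have h4 := h s' hs'
    unfold foldCol at h4
    rcases h3 with ⟨h3, rfl⟩ | h3 | h3 <;> split_ifs at h4 <;> omega

lemma below_mirror {k j : ℕ} (hj : j ≤ 2 * k) :
    (P.mirror k).below j = P.below (foldCol k j) := by
  ext i
  simp only [below, Equiv.coe_fn_mk, P.cut_mirror hj]

end PuncturedCylinder

/-! ### The measurement front and the labels of the mirrored graph. -/

namespace PuncturedCylinder

variable (P : PuncturedCylinder)

lemma cut_zero : P.cut 0 = 0 := P.cut_eq_zero fun s hs h => by
  have := P.slot_columns s hs
  omega

lemma cut_of_last_le {j : ℕ} (hj : P.M ≤ j + 1) : P.cut j = 0 := P.cut_eq_zero fun s hs h => by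
  have := P.slot_columns s hs
  omega

lemma below_val {j : ℕ} {i : Fin P.N} (h : P.cut j = 0) (hi : i.1 + 1 < P.N) :
    (P.below j i).1 = i.1 + 1 := by
  have : i.1 + 1 ≠ P.N := by omega
  simp [below, h, this]

lemma below_symm_val {j : ℕ} {i : Fin P.N} (h : P.cut j = 0) (hi : 0 < i.1) :
    ((P.below j).symm i).1 = i.1 - 1 := by
  have : i.1 ≠ 0 := by omega
  simp [below, h, this]

/-- `c` is the last column with measured vertical edges, and `a` edges are measured among the
vertical edges of this column and the horizontal edges to the right of it. -/
structure IsFront (c a : ℕ) : Prop where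
  pos : 1 ≤ a
  le : a ≤ 2 * P.N
  lt : c < P.M
  last : c + 1 = P.M → a ≤ P.N

/-- The edges that have been measured when the front is at `(c, a)`. -/
noncomputable abbrev part (c a : ℕ) : Finset P.Edge := P.measured (2 * P.N * c + a)

variable {P} {c a : ℕ}

/-- Dividing `t - 1` rather than `t` puts `a` in `1, …, 2N`, so the front moves to a new column only
once a vertical edge of it is measured. -/
lemma exists_isFront {t : ℕ} (ht : 1 ≤ t) (ht' : t ≤ Fintype.card P.Edge) :
    ∃ c a, P.IsFront c a ∧ t = 2 * P.N * c + a := by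
  have hN := P.rows
  have hM := P.columns
  have h0 : 0 < 2 * P.N := by omega
  have h1 := Nat.div_add_mod (t - 1) (2 * P.N)
  have h2 := Nat.mod_lt (t - 1) h0
  simp only [Fintype.card_sum, Fintype.card_prod, Fintype.card_fin] at ht'
  obtain ⟨m, hm⟩ : ∃ m, P.M = m + 1 := ⟨P.M - 1, by omega⟩
  rw [hm, Nat.add_sub_cancel] at ht'
  have h3 : t ≤ 2 * P.N * m + P.N := by nlinarith
  refine ⟨(t - 1) / (2 * P.N), (t - 1) % (2 * P.N) + 1, ⟨by omega, by omega, ?_, ?_⟩, by omega⟩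
  · by_contra h4
    have h5 : 2 * P.N * (m + 1) ≤ 2 * P.N * ((t - 1) / (2 * P.N)) :=
      Nat.mul_le_mul_left _ (by omega)
    rw [mul_add] at h5
    omega
  · intro h4
    have h5 : (t - 1) / (2 * P.N) = m := by omega
    rw [h5] at h1
    omega

lemma mem_part {e : P.Edge} : e ∈ P.part c a ↔ P.position e < 2 * P.N * c + a := by
  simp only [part, measured, Finset.mem_filter, Finset.mem_univ, true_and]

lemma IsFront.inl_mem (h : P.IsFront c a) {i : Fin P.N} {j : Fin P.M} :
    (.inl (i, j) : P.Edge) ∈ P.part c a ↔ j.1 < c ∨ (j.1 = c ∧ i.1 < a) := by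
  have := i.2
  have := h.le
  have := h.pos
  rw [mem_part, position]
  rcases lt_trichotomy j.1 c with hj | hj | hj
  · have : 2 * P.N * (j.1 + 1) ≤ 2 * P.N * c := Nat.mul_le_mul_left _ hj
    rw [mul_add] at this
    omega
  · rw [hj]
    omega
  · have : 2 * P.N * (c + 1) ≤ 2 * P.N * j.1 := Nat.mul_le_mul_left _ hj
    rw [mul_add] at this
    omega

lemma IsFront.inr_mem (h : P.IsFront c a) {i : Fin P.N} {j : Fin (P.M - 1)} :
    (.inr (i, j) : P.Edge) ∈ P.part c a ↔ j.1 < c ∨ (j.1 = c ∧ P.N + i.1 < a) := by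
  have := i.2
  have := h.le
  have := h.pos
  rw [mem_part, position]
  rcases lt_trichotomy j.1 c with hj | hj | hj
  · have : 2 * P.N * (j.1 + 1) ≤ 2 * P.N * c := Nat.mul_le_mul_left _ hj
    rw [mul_add] at this
    omega
  · rw [hj]
    omega
  · have : 2 * P.N * (c + 1) ≤ 2 * P.N * j.1 := Nat.mul_le_mul_left _ hj
    rw [mul_add] at this
    omega

variable (P c a)

/-- All edges at the vertex `v` have been measured. -/
def IsInner (v : P.Vertex) : Prop := ∀ e, P.graph.Incident v e → e ∈ P.part c a

/-- The gap between columns that has gap `j` as its copy or mirror image. -/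
def foldGap (k j : ℕ) : ℕ := if j < k then j else 2 * k - 1 - j

/-- The copy (`false`) or mirror image (`true`) of an edge. -/
def copyEdge : Bool → P.Edge → (P.mirror (c + 1)).Edge
  | false, .inl (i, j) => .inl (i, ⟨min j.1 (2 * (c + 1)), by simp only; omega⟩)
  | true, .inl (i, j) => .inl (i, ⟨2 * (c + 1) - j.1, by simp only; omega⟩)
  | false, .inr (i, j) => .inr (i, ⟨min j.1 (2 * c + 1), by simp only; omega⟩)
  | true, .inr (i, j) => .inr (i, ⟨2 * c + 1 - j.1, by simp only; omega⟩)

/-- The edges that are measured in `|+⟩`, unless they are copies of measured edges. -/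
def IsPlus : (P.mirror (c + 1)).Edge → Prop
  -- With the front in column 0, the rows below `a` are untouched and have no counterpart in the
  -- double; these edges contract them to row `a`. The wrap-around edge is left out to keep the
  -- contracted edges a forest.
  | .inl (i, j) => c = 0 ∧ j.1 = 0 ∧ a ≤ i.1 ∧ i.1 + 1 < P.N
  -- Left of the mirror column every unmeasured horizontal edge is contracted. On the right this
  -- happens only where the front vertex is not inner; an inner vertex keeps two separate copies.
  | .inr (i, j) => c < j.1 → ∀ hc : c < P.M, ¬ P.IsInner c a (i, ⟨c, hc⟩)

/-- The labels of the edges of the mirrored graph. -/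
noncomputable def mirrorLab (e' : (P.mirror (c + 1)).Edge) : EdgeLabel {e // e ∈ P.part c a} :=
  if h : ∃ e : {e // e ∈ P.part c a}, e' = P.copyEdge c false e then .fst h.choose
  else if h : ∃ e : {e // e ∈ P.part c a}, e' = P.copyEdge c true e then .snd h.choose
  else if P.IsPlus c a e' then .plus else .zero

variable {P c a}

lemma IsFront.copyEdge_inj (h : P.IsFront c a) {b b' : Bool} {e e' : P.Edge}
    (he : e ∈ P.part c a) (he' : e' ∈ P.part c a) (heq : P.copyEdge c b e = P.copyEdge c b' e') :
    b = b' ∧ e = e' := by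
  rcases e with ⟨i, j⟩ | ⟨i, j⟩ <;> rcases e' with ⟨i', j'⟩ | ⟨i', j'⟩
  · rw [h.inl_mem] at he he'
    rcases b with _ | _ <;> rcases b' with _ | _ <;>
      simp only [copyEdge, Sum.inl.injEq, Prod.mk.injEq, Fin.ext_iff] at heq ⊢ <;>
      first | exact ⟨trivial, heq.1, by omega⟩ | (exfalso; omega)
  · rcases b with _ | _ <;> rcases b' with _ | _ <;> simp [copyEdge] at heq
  · rcases b with _ | _ <;> rcases b' with _ | _ <;> simp [copyEdge] at heq
  · rw [h.inr_mem] at he he'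
    rcases b with _ | _ <;> rcases b' with _ | _ <;>
      simp only [copyEdge, Sum.inr.injEq, Prod.mk.injEq, Fin.ext_iff] at heq ⊢ <;>
      first | exact ⟨trivial, heq.1, by omega⟩ | (exfalso; omega)

lemma IsFront.mirrorLab_fst (h : P.IsFront c a) (e : {e // e ∈ P.part c a})
    (e' : (P.mirror (c + 1)).Edge) :
    P.mirrorLab c a e' = .fst e ↔ e' = P.copyEdge c false e := by
  unfold mirrorLab
  constructor
  · intro hl
    split_ifs at hl with h1
    rw [← EdgeLabel.fst.inj hl]
    exact h1.choose_spec
  · intro hl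
    have h1 : ∃ e : {e // e ∈ P.part c a}, e' = P.copyEdge c false e := ⟨e, hl⟩
    rw [dif_pos h1]
    exact congrArg _ (Subtype.ext (h.copyEdge_inj h1.choose.2 e.2
      (h1.choose_spec.symm.trans hl)).2)

lemma IsFront.mirrorLab_snd (h : P.IsFront c a) (e : {e // e ∈ P.part c a})
    (e' : (P.mirror (c + 1)).Edge) :
    P.mirrorLab c a e' = .snd e ↔ e' = P.copyEdge c true e := by
  unfold mirrorLab
  constructor
  · intro hl
    split_ifs at hl with h1 h2
    rw [← EdgeLabel.snd.inj hl]
    exact h2.choose_spec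
  · intro hl
    have h1 : ¬ ∃ e : {e // e ∈ P.part c a}, e' = P.copyEdge c false e := by
      rintro ⟨e₂, h2⟩
      exact absurd (h.copyEdge_inj e₂.2 e.2 (h2.symm.trans hl)).1 Bool.false_ne_true
    have h2 : ∃ e : {e // e ∈ P.part c a}, e' = P.copyEdge c true e := ⟨e, hl⟩
    rw [dif_neg h1, dif_pos h2]
    exact congrArg _ (Subtype.ext (h.copyEdge_inj h2.choose.2 e.2
      (h2.choose_spec.symm.trans hl)).2)

lemma mirrorLab_plus {e' : (P.mirror (c + 1)).Edge} : P.mirrorLab c a e' = .plus ↔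
    (∀ b, ∀ e ∈ P.part c a, e' ≠ P.copyEdge c b e) ∧ P.IsPlus c a e' := by
  unfold mirrorLab
  split_ifs with h1 h2 h3
  · exact iff_of_false not_false fun h => h.1 false _ h1.choose.2 h1.choose_spec
  · exact iff_of_false not_false fun h => h.1 true _ h2.choose.2 h2.choose_spec
  · refine iff_of_true rfl ⟨?_, h3⟩
    rintro (_ | _) e he heq
    exacts [h1 ⟨⟨e, he⟩, heq⟩, h2 ⟨⟨e, he⟩, heq⟩]
  · exact iff_of_false not_false fun h => h3 h.2

lemma mirrorLab_zero {e' : (P.mirror (c + 1)).Edge} : P.mirrorLab c a e' = .zero ↔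
    (∀ b, ∀ e ∈ P.part c a, e' ≠ P.copyEdge c b e) ∧ ¬ P.IsPlus c a e' := by
  unfold mirrorLab
  split_ifs with h1 h2 h3
  · exact iff_of_false not_false fun h => h.1 false _ h1.choose.2 h1.choose_spec
  · exact iff_of_false not_false fun h => h.1 true _ h2.choose.2 h2.choose_spec
  · exact iff_of_false not_false fun h => h.2 h3
  · refine iff_of_true rfl ⟨?_, h3⟩
    rintro (_ | _) e he heq
    exacts [h1 ⟨⟨e, he⟩, heq⟩, h2 ⟨⟨e, he⟩, heq⟩]

lemma IsFront.not_copy_inl (h : P.IsFront c a) {i : Fin P.N} {j : Fin (2 * (c + 1) + 1)} :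
    (∀ b, ∀ e ∈ P.part c a, (.inl (i, j) : (P.mirror (c + 1)).Edge) ≠ P.copyEdge c b e) ↔
      ¬ (foldCol (c + 1) j < c ∨ (foldCol (c + 1) j = c ∧ i.1 < a)) := by
  have hlt := h.lt
  have hj := j.2
  constructor
  · intro hne hm
    have hlt' : foldCol (c + 1) j < P.M := by omega
    have hmem : (.inl (i, ⟨foldCol (c + 1) j, hlt'⟩) : P.Edge) ∈ P.part c a := h.inl_mem.mpr hm
    by_cases hjk : j.1 ≤ c + 1
    · refine hne false _ hmem ?_
      refine congrArg Sum.inl (Prod.ext rfl (Fin.ext ?_))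
      change j.1 = min (foldCol (c + 1) j) (2 * (c + 1))
      rw [foldCol, if_pos hjk]
      omega
    · refine hne true _ hmem ?_
      refine congrArg Sum.inl (Prod.ext rfl (Fin.ext ?_))
      change j.1 = 2 * (c + 1) - foldCol (c + 1) j
      rw [foldCol, if_neg hjk]
      omega
  · intro hm b e he heq
    apply hm
    rcases e with ⟨i', j'⟩ | ⟨i', j'⟩
    · rw [h.inl_mem] at he
      unfold foldCol
      rcases b with _ | _ <;>
        simp only [copyEdge, Sum.inl.injEq, Prod.mk.injEq, Fin.ext_iff] at heq <;>
        split_ifs <;> omega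
    · rcases b with _ | _ <;> simp [copyEdge] at heq

lemma IsFront.not_copy_inr (h : P.IsFront c a) {i : Fin P.N} {j : Fin (2 * (c + 1) + 1 - 1)} :
    (∀ b, ∀ e ∈ P.part c a, (.inr (i, j) : (P.mirror (c + 1)).Edge) ≠ P.copyEdge c b e) ↔
      ¬ (foldGap (c + 1) j < c ∨ (foldGap (c + 1) j = c ∧ P.N + i.1 < a)) := by
  have hlt := h.lt
  have hj := j.2
  have hlast := h.last
  constructor
  · intro hne hm
    have hlt' : foldGap (c + 1) j < P.M - 1 := by omega
    have hmem : (.inr (i, ⟨foldGap (c + 1) j, hlt'⟩) : P.Edge) ∈ P.part c a := h.inr_mem.mpr hm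
    by_cases hjk : j.1 < c + 1
    · refine hne false _ hmem ?_
      refine congrArg Sum.inr (Prod.ext rfl (Fin.ext ?_))
      change j.1 = min (foldGap (c + 1) j) (2 * c + 1)
      rw [foldGap, if_pos hjk]
      omega
    · refine hne true _ hmem ?_
      refine congrArg Sum.inr (Prod.ext rfl (Fin.ext ?_))
      change j.1 = 2 * c + 1 - foldGap (c + 1) j
      rw [foldGap, if_neg hjk]
      omega
  · intro hm b e he heq
    apply hm
    rcases e with ⟨i', j'⟩ | ⟨i', j'⟩
    · rcases b with _ | _ <;> simp [copyEdge] at heq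
    · rw [h.inr_mem] at he
      unfold foldGap
      rcases b with _ | _ <;>
        simp only [copyEdge, Sum.inr.injEq, Prod.mk.injEq, Fin.ext_iff] at heq <;>
        split_ifs <;> omega

end PuncturedCylinder

/-! ### Inner vertices, and uniqueness of a cycle with given restrictions. -/

namespace PuncturedCylinder

variable {P : PuncturedCylinder} {c a : ℕ}

lemma IsFront.isInner_of_lt (h : P.IsFront c a) {i : Fin P.N} {j : Fin P.M} (hj : j.1 < c) :
    P.IsInner c a (i, j) := by
  rintro (⟨i', j'⟩ | ⟨i', j'⟩) (he | he)
  · exact h.inl_mem.mpr (Or.inl ((congrArg (fun v => v.2.1) he).trans_lt hj))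
  · exact h.inl_mem.mpr (Or.inl ((congrArg (fun v => v.2.1) he).trans_lt hj))
  · exact h.inr_mem.mpr (Or.inl ((congrArg (fun v => v.2.1) he).trans_lt hj))
  · have : j'.1 + 1 = j.1 := congrArg (fun v => v.2.1) he
    exact h.inr_mem.mpr (Or.inl (by omega))

lemma IsFront.isInner_of_horizontal (h : P.IsFront c a) {i : Fin P.N} {j : Fin P.M}
    (hj : j.1 = c) (hi : P.N + i.1 < a) : P.IsInner c a (i, j) := by
  rintro (⟨i', j'⟩ | ⟨i', j'⟩) (he | he)
  · have h1 : j'.1 = j.1 := congrArg (fun v => v.2.1) he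
    have := i'.2
    exact h.inl_mem.mpr (Or.inr (by omega))
  · have h1 : j'.1 = j.1 := congrArg (fun v => v.2.1) he
    have := i'.2
    exact h.inl_mem.mpr (Or.inr (by omega))
  · have h1 : j'.1 = j.1 := congrArg (fun v => v.2.1) he
    have h2 : i' = i := congrArg (fun v => v.1) he
    exact h.inr_mem.mpr (Or.inr ⟨by omega, h2 ▸ hi⟩)
  · have h1 : j'.1 + 1 = j.1 := congrArg (fun v => v.2.1) he
    exact h.inr_mem.mpr (Or.inl (by omega))

/-- Row 0 is excluded because the edge above it is the wrap-around edge, measured last in its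
column. -/
lemma IsFront.isInner_of_last (h : P.IsFront c a) (hc : c + 1 = P.M) {i : Fin P.N} {j : Fin P.M}
    (hj : j.1 = c) (hi : 0 < i.1) (hi' : i.1 < a) : P.IsInner c a (i, j) := by
  rintro (⟨i', j'⟩ | ⟨i', j'⟩) (he | he)
  · have h1 : j'.1 = j.1 := congrArg (fun v => v.2.1) he
    have h2 : i' = i := congrArg (fun v => v.1) he
    exact h.inl_mem.mpr (Or.inr ⟨by omega, h2 ▸ hi'⟩)
  · have h1 : j'.1 = j.1 := congrArg (fun v => v.2.1) he
    have h2 : P.below j'.1 i' = i := congrArg (fun v => v.1) he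
    have h3 := P.below_symm_val (P.cut_of_last_le (by omega) : P.cut j'.1 = 0) hi
    rw [← Equiv.eq_symm_apply] at h2
    rw [← h2] at h3
    exact h.inl_mem.mpr (Or.inr (by omega))
  · have h1 : j'.1 = j.1 := congrArg (fun v => v.2.1) he
    have := j'.2
    omega
  · have h1 : j'.1 + 1 = j.1 := congrArg (fun v => v.2.1) he
    exact h.inr_mem.mpr (Or.inl (by omega))

lemma vertBit_of_lt (z : P.Edge → ZMod 2) (i : Fin P.N) {j : ℕ} (hj : j < P.M) :
    P.vertBit z i j = z (.inl (i, ⟨j, hj⟩)) := dif_pos hj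

lemma horBit_of_lt (z : P.Edge → ZMod 2) (i : Fin P.N) {j : ℕ} (hj : j < P.M - 1) :
    P.horBit z i j = z (.inr (i, ⟨j, hj⟩)) := dif_pos hj

lemma horBit_of_le (z : P.Edge → ZMod 2) (i : Fin P.N) {j : ℕ} (hj : P.M - 1 ≤ j) :
    P.horBit z i j = 0 := dif_neg (by omega)

section

variable (z : (P.mirror (c + 1)).Edge → ZMod 2)

/-- The `min` in `copyEdge` only keeps the index in range and is inactive up to column `c`. -/
lemma apply_copyEdge_false_inl (i : Fin P.N) (j : Fin P.M) (hj : j.1 ≤ c) :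
    z (P.copyEdge c false (.inl (i, j))) = (P.mirror (c + 1)).vertBit z i j := by
  rw [vertBit_of_lt z i (show j.1 < 2 * (c + 1) + 1 by omega)]
  exact congrArg (fun j => z (.inl (i, j))) (Fin.ext (min_eq_left (by omega)))

lemma apply_copyEdge_true_inl (i : Fin P.N) (j : Fin P.M) :
    z (P.copyEdge c true (.inl (i, j))) =
      (P.mirror (c + 1)).vertBit z i (2 * (c + 1) - j.1) :=
  (vertBit_of_lt z i (show 2 * (c + 1) - j.1 < 2 * (c + 1) + 1 by omega)).symm

lemma apply_copyEdge_false_inr (i : Fin P.N) (j : Fin (P.M - 1)) (hj : j.1 ≤ c) :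
    z (P.copyEdge c false (.inr (i, j))) = (P.mirror (c + 1)).horBit z i j := by
  rw [horBit_of_lt z i (show j.1 < 2 * (c + 1) + 1 - 1 by omega)]
  exact congrArg (fun j => z (.inr (i, j))) (Fin.ext (min_eq_left (by omega)))

lemma apply_copyEdge_true_inr (i : Fin P.N) (j : Fin (P.M - 1)) :
    z (P.copyEdge c true (.inr (i, j))) =
      (P.mirror (c + 1)).horBit z i (2 * c + 1 - j.1) :=
  (horBit_of_lt z i (show 2 * c + 1 - j.1 < 2 * (c + 1) + 1 - 1 by omega)).symm

variable {z}

lemma mem_cycles_mirror_iff : z ∈ (P.mirror (c + 1)).graph.cycles ↔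
    ∀ (i : Fin P.N) j, j ≤ 2 * (c + 1) →
      (P.mirror (c + 1)).vertBit z i j +
        (P.mirror (c + 1)).vertBit z ((P.below (foldCol (c + 1) j)).symm i) j +
        (P.mirror (c + 1)).horBit z i j +
        (if j = 0 then 0 else (P.mirror (c + 1)).horBit z i (j - 1)) = 0 := by
  rw [mem_cycles_iff]
  refine forall_congr' fun i => forall_congr' fun j => ?_
  constructor
  · intro h hj
    rw [← P.below_mirror hj]
    exact h (by simp only; omega)
  · intro h hj
    rw [P.below_mirror (by simp only at hj; omega)]
    exact h (by simp only at hj; omega)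

/-- In a cycle that avoids the edges labelled `zero`, all vertical edges that are not copies of
measured edges vanish. -/
lemma IsFront.vertBit_eq_zero (h : P.IsFront c a) (hz : z ∈ (P.mirror (c + 1)).graph.cycles)
    (hz0 : ∀ e', P.mirrorLab c a e' = .zero → z e' = 0) {i : Fin P.N} {j : ℕ}
    (hj : j ≤ 2 * (c + 1))
    (hm : ¬ (foldCol (c + 1) j < c ∨ (foldCol (c + 1) j = c ∧ i.1 < a))) :
    (P.mirror (c + 1)).vertBit z i j = 0 := by
  have hlab : ∀ {i : Fin P.N} {j : ℕ}, j ≤ 2 * (c + 1) →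
      ¬ (foldCol (c + 1) j < c ∨ (foldCol (c + 1) j = c ∧ i.1 < a)) →
      ¬ (c = 0 ∧ j = 0 ∧ a ≤ i.1 ∧ i.1 + 1 < P.N) →
      (P.mirror (c + 1)).vertBit z i j = 0 := by
    intro i j hj hm hp
    have hj' : j < 2 * (c + 1) + 1 := by omega
    rw [vertBit_of_lt z i hj']
    exact hz0 _ (mirrorLab_zero.mpr ⟨(h.not_copy_inl (j := ⟨j, hj'⟩)).mpr hm, hp⟩)
  by_cases hp : c = 0 ∧ j = 0 ∧ a ≤ i.1 ∧ i.1 + 1 < P.N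
  swap
  · exact hlab hj hm hp
  obtain ⟨rfl, rfl, hi, -⟩ := hp
  rw [mem_cycles_mirror_iff] at hz
  have hf0 : foldCol (0 + 1) 0 = 0 := rfl
  have hf1 : foldCol (0 + 1) 1 = 1 := rfl
  have hf2 : foldCol (0 + 1) 2 = 0 := rfl
  -- Only the contracted edges of column 0 remain. Below row `a` the vertical edges of columns 2 and
  -- 1 are all labelled `zero`, so the vertex conditions there successively kill both horizontal
  -- edges of the row.
  have hor : ∀ i : Fin P.N, a < i.1 → (P.mirror (0 + 1)).horBit z i 0 = 0 := by
    intro i hi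
    have hb := P.below_symm_val P.cut_zero (show 0 < i.1 by omega)
    have h2 := hz i 2 (by omega)
    rw [hf2, hlab (by omega) (by omega) (by omega),
      hlab (by omega) (by omega) (by omega), horBit_of_le z i (j := 2) (by simp)] at h2
    have h1 := hz i 1 (by omega)
    rw [hf1, hlab (by omega) (by omega) (by omega),
      hlab (by omega) (by omega) (by omega)] at h1
    norm_num at h1 h2
    rwa [h2, zero_add] at h1
  -- Induction upwards from the wrap-around edge, which is labelled `zero`.
  have hend : ∀ n : ℕ, ∀ i : Fin P.N, i.1 + n + 1 = P.N → a ≤ i.1 →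
      (P.mirror (0 + 1)).vertBit z i 0 = 0 := by
    intro n
    induction n with
    | zero => exact fun i hn hi => hlab (by omega) (by omega) (by omega)
    | succ n ih =>
      intro i hn hi
      have hi1 : i.1 + 1 < P.N := by omega
      have hb : (P.below 0).symm ⟨i.1 + 1, hi1⟩ = i :=
        Fin.ext (P.below_symm_val P.cut_zero (Nat.succ_pos _))
      have h0 := hz ⟨i.1 + 1, hi1⟩ 0 (by omega)
      rw [hf0, hb, ih _ (by simp only; omega) (by simp only; omega),
        hor _ (by simp only; omega)] at h0
      simpa using h0
  have := i.2
  exact hend (P.N - 1 - i.1) i (by omega) hi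

end

/-- A cycle that avoids the edges labelled `zero` and the copies of the measured edges vanishes. -/
lemma IsFront.eq_zero (h : P.IsFront c a) {z : (P.mirror (c + 1)).Edge → ZMod 2}
    (hz : z ∈ (P.mirror (c + 1)).graph.cycles)
    (hz0 : ∀ e', P.mirrorLab c a e' = .zero → z e' = 0)
    (h1 : ∀ b, ∀ e ∈ P.part c a, z (P.copyEdge c b e) = 0) : z = 0 := by
  have hv : ∀ (i : Fin P.N) j, j ≤ 2 * (c + 1) → (P.mirror (c + 1)).vertBit z i j = 0 := by
    intro i j hj
    by_cases hm : foldCol (c + 1) j < c ∨ (foldCol (c + 1) j = c ∧ i.1 < a)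
    · have hj' : j < 2 * (c + 1) + 1 := by omega
      rw [vertBit_of_lt z i hj']
      by_contra hne
      refine (h.not_copy_inl (i := i) (j := ⟨j, hj'⟩)).mp (fun b e he heq => hne ?_) hm
      exact (congrArg z heq).trans (h1 b e he)
    · exact h.vertBit_eq_zero hz hz0 hj hm
  have hh : ∀ (i : Fin P.N) j, j < 2 * (c + 1) → foldGap (c + 1) j < c →
      (P.mirror (c + 1)).horBit z i j = 0 := by
    intro i j hj hm
    have hj' : j < 2 * (c + 1) + 1 - 1 := by omega
    rw [horBit_of_lt z i hj']
    by_contra hne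
    refine (h.not_copy_inr (i := i) (j := ⟨j, hj'⟩)).mp (fun b e he heq => hne ?_) (Or.inl hm)
    exact (congrArg z heq).trans (h1 b e he)
  rw [mem_cycles_mirror_iff] at hz
  -- At a front vertex all edges except the one to the right are known to vanish; the vertex
  -- condition kills that one, and then its neighbour across the mirror column.
  have hc : ∀ i : Fin P.N, (P.mirror (c + 1)).horBit z i c = 0 := by
    intro i
    have h2 := hz i c (by omega)
    rw [hv _ _ (by omega), hv _ _ (by omega)] at h2
    by_cases hc0 : c = 0
    · simpa [hc0] using h2
    · rw [if_neg hc0, hh i (c - 1) (by omega) (by unfold foldGap; split_ifs <;> omega)] at h2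
      simpa using h2
  have hc' : ∀ i : Fin P.N, (P.mirror (c + 1)).horBit z i (c + 1) = 0 := by
    intro i
    have h2 := hz i (c + 1) (by omega)
    rw [hv _ _ (by omega), hv _ _ (by omega), if_neg (Nat.succ_ne_zero c),
      Nat.add_sub_cancel, hc] at h2
    simpa using h2
  funext e
  rcases e with ⟨i, j⟩ | ⟨i, j⟩
  · have hj : j.1 < 2 * (c + 1) + 1 := j.2
    exact (vertBit_of_lt z i j.2).symm.trans (hv i j.1 (by omega))
  · have hj : j.1 < 2 * (c + 1) + 1 - 1 := j.2
    refine (horBit_of_lt z i j.2).symm.trans ?_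
    by_cases hjc : j.1 = c
    · rw [hjc]; exact hc i
    by_cases hjc' : j.1 = c + 1
    · rw [hjc']; exact hc' i
    exact hh i j.1 (by omega) (by unfold foldGap; split_ifs <;> omega)

end PuncturedCylinder

/-! ### Gluing two cycles with a common completion. -/

namespace PuncturedCylinder

variable {P : PuncturedCylinder} {c a : ℕ}

section

variable (P c a)

/-- The parity of the measured edges at the vertex in row `i` of the front column, apart from the
horizontal edge to the right. -/
def frontParity (w : P.Edge → ZMod 2) (i : Fin P.N) : ZMod 2 :=
  (if i.1 < a then P.vertBit w i c else 0) +
    (if ((P.below c).symm i).1 < a then P.vertBit w ((P.below c).symm i) c else 0) +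
    if c = 0 then 0 else P.horBit w i (c - 1)

/-- The cycle of the mirrored graph made from the measured parts of two cycles. -/
def mirrorCycle (w w' : P.Edge → ZMod 2) : (P.mirror (c + 1)).Edge → ZMod 2
  | .inl (i, j) =>
    if foldCol (c + 1) j < c ∨ (foldCol (c + 1) j = c ∧ i.1 < a) then
      P.vertBit (if j.1 ≤ c then w else w') i (foldCol (c + 1) j) else 0
  | .inr (i, j) =>
    if foldGap (c + 1) j = c then P.frontParity c a (if j.1 ≤ c then w else w') i
    else P.horBit (if j.1 ≤ c then w else w') i (foldGap (c + 1) j)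

end

variable {w w' : P.Edge → ZMod 2}

lemma IsFront.frontParity_of_horizontal (h : P.IsFront c a) (hw : w ∈ P.graph.cycles)
    {i : Fin P.N} (hi : P.N + i.1 < a) : P.frontParity c a w i = P.horBit w i c := by
  have h1 := (P.mem_cycles_iff w).mp hw i c h.lt
  have := ((P.below c).symm i).2
  rw [frontParity, if_pos (by omega), if_pos (by omega)]
  generalize (if c = 0 then 0 else P.horBit w i (c - 1)) = s at h1 ⊢
  generalize P.vertBit w i c = p at h1 ⊢
  generalize P.vertBit w ((P.below c).symm i) c = q at h1 ⊢
  generalize P.horBit w i c = r at h1 ⊢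
  revert p q r s
  decide

/-- An inner vertex with no measured edge to its right has no edge to its right at all, so the
parity is its full vertex condition. -/
lemma IsFront.frontParity_of_isInner (h : P.IsFront c a) (hw : w ∈ P.graph.cycles)
    {i : Fin P.N} (hi : P.IsInner c a (i, ⟨c, h.lt⟩)) (hi' : ¬ P.N + i.1 < a) :
    P.frontParity c a w i = 0 := by
  have h1 := (P.mem_cycles_iff w).mp hw i c h.lt
  have h2 := h.inl_mem.mp (hi (.inl (i, ⟨c, h.lt⟩)) (Or.inl rfl))
  have h3 := h.inl_mem.mp (hi (.inl ((P.below c).symm i, ⟨c, h.lt⟩))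
    (Or.inr (Prod.ext (Equiv.apply_symm_apply _ _) rfl)))
  have h4 : P.horBit w i c = 0 := by
    refine dif_neg fun hc => hi' ?_
    have := h.inr_mem.mp (hi (.inr (i, ⟨c, hc⟩)) (Or.inl rfl))
    simp only at this
    omega
  simp only at h2 h3
  rw [h4, add_zero] at h1
  rw [frontParity, if_pos (by omega), if_pos (by omega), h1]

lemma IsFront.vertBit_eq (h : P.IsFront c a) (hww' : ∀ e ∉ P.part c a, w e = w' e)
    {i : Fin P.N} {j : ℕ} (hj : c < j ∨ (j = c ∧ a ≤ i.1)) :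
    P.vertBit w i j = P.vertBit w' i j := by
  unfold vertBit
  split_ifs with hjM
  · refine hww' _ fun hmem => ?_
    have := h.inl_mem.mp hmem
    simp only at this
    omega
  · rfl

lemma IsFront.horBit_eq (h : P.IsFront c a) (hww' : ∀ e ∉ P.part c a, w e = w' e)
    {i : Fin P.N} {j : ℕ} (hj : c < j ∨ (j = c ∧ a ≤ P.N + i.1)) :
    P.horBit w i j = P.horBit w' i j := by
  unfold horBit
  split_ifs with hjM
  · refine hww' _ fun hmem => ?_
    have := h.inr_mem.mp hmem
    simp only at this
    omega
  · rfl

/-- By the vertex condition the parity equals the sum over the remaining edges at the vertex. If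
these are unmeasured, `w` and `w'` agree on them. If the right horizontal edge is measured, it is
the only measured edge at its other end, so its bit is also fixed by unmeasured edges. -/
lemma IsFront.frontParity_eq (h : P.IsFront c a) (hw : w ∈ P.graph.cycles)
    (hw' : w' ∈ P.graph.cycles) (hww' : ∀ e ∉ P.part c a, w e = w' e) (i : Fin P.N) :
    P.frontParity c a w i = P.frontParity c a w' i := by
  have two : (2 : ZMod 2) = 0 := by decide
  by_cases hi : P.N + i.1 < a
  · have hlt := h.lt
    have hlast := h.last
    have hc : c + 1 < P.M := by omega
    rw [h.frontParity_of_horizontal hw hi, h.frontParity_of_horizontal hw' hi]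
    have h1 := (P.mem_cycles_iff w).mp hw i (c + 1) hc
    have h2 := (P.mem_cycles_iff w').mp hw' i (c + 1) hc
    rw [if_neg (Nat.succ_ne_zero c), Nat.add_sub_cancel] at h1 h2
    rw [h.vertBit_eq hww' (Or.inl (Nat.lt_succ_self c)),
      h.vertBit_eq hww' (Or.inl (Nat.lt_succ_self c)),
      h.horBit_eq hww' (Or.inl (Nat.lt_succ_self c))] at h1
    linear_combination h1 - h2
  · have h1 := (P.mem_cycles_iff w).mp hw i c h.lt
    have h2 := (P.mem_cycles_iff w').mp hw' i c h.lt
    have h3 : ∀ i : Fin P.N, P.vertBit w i c + (if i.1 < a then P.vertBit w i c else 0) =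
        P.vertBit w' i c + if i.1 < a then P.vertBit w' i c else 0 := by
      intro i
      split_ifs with hia
      · rw [CharTwo.add_self_eq_zero, CharTwo.add_self_eq_zero]
      · rw [h.vertBit_eq hww' (Or.inr ⟨rfl, by omega⟩)]
    have h4 := h.horBit_eq hww' (i := i) (j := c) (Or.inr ⟨rfl, by omega⟩)
    unfold frontParity
    linear_combination h3 i + h3 ((P.below c).symm i) - h1 + h2 + h4 +
      ((if c = 0 then 0 else P.horBit w i (c - 1)) -
        (if c = 0 then 0 else P.horBit w' i (c - 1))) * two

section

variable (w w')

lemma vertBit_mirrorCycle_left {i : Fin P.N} {j : ℕ} (hj : j ≤ c) :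
    (P.mirror (c + 1)).vertBit (P.mirrorCycle c a w w') i j =
      if j < c ∨ (j = c ∧ i.1 < a) then P.vertBit w i j else 0 := by
  rw [vertBit_of_lt _ _ (show j < 2 * (c + 1) + 1 by omega)]
  have : foldCol (c + 1) j = j := if_pos (by omega)
  simp only [mirrorCycle, this, if_pos hj]

lemma vertBit_mirrorCycle_middle {i : Fin P.N} :
    (P.mirror (c + 1)).vertBit (P.mirrorCycle c a w w') i (c + 1) = 0 := by
  rw [vertBit_of_lt _ _ (show c + 1 < 2 * (c + 1) + 1 by omega)]
  have : foldCol (c + 1) (c + 1) = c + 1 := if_pos le_rfl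
  simp only [mirrorCycle, this]
  exact if_neg (by omega)

lemma vertBit_mirrorCycle_right {i : Fin P.N} {j : ℕ} (hj : j ≤ c) :
    (P.mirror (c + 1)).vertBit (P.mirrorCycle c a w w') i (2 * (c + 1) - j) =
      if j < c ∨ (j = c ∧ i.1 < a) then P.vertBit w' i j else 0 := by
  rw [vertBit_of_lt _ _ (show 2 * (c + 1) - j < 2 * (c + 1) + 1 by omega)]
  have : foldCol (c + 1) (2 * (c + 1) - j) = j := (if_neg (by omega)).trans (by omega)
  simp only [mirrorCycle, this, if_neg (show ¬ 2 * (c + 1) - j ≤ c by omega)]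

lemma horBit_mirrorCycle_left {i : Fin P.N} {j : ℕ} (hj : j < c) :
    (P.mirror (c + 1)).horBit (P.mirrorCycle c a w w') i j = P.horBit w i j := by
  rw [horBit_of_lt _ _ (show j < 2 * (c + 1) + 1 - 1 by omega)]
  have : foldGap (c + 1) j = j := if_pos (by omega)
  simp only [mirrorCycle, this, if_pos hj.le, if_neg hj.ne]

lemma horBit_mirrorCycle_front {i : Fin P.N} :
    (P.mirror (c + 1)).horBit (P.mirrorCycle c a w w') i c = P.frontParity c a w i := by
  rw [horBit_of_lt _ _ (show c < 2 * (c + 1) + 1 - 1 by omega)]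
  have : foldGap (c + 1) c = c := if_pos (by omega)
  simp only [mirrorCycle, this, if_pos le_rfl, if_true]

lemma horBit_mirrorCycle_front' {i : Fin P.N} :
    (P.mirror (c + 1)).horBit (P.mirrorCycle c a w w') i (c + 1) = P.frontParity c a w' i := by
  rw [horBit_of_lt _ _ (show c + 1 < 2 * (c + 1) + 1 - 1 by omega)]
  have : foldGap (c + 1) (c + 1) = c := (if_neg (by omega)).trans (by omega)
  simp only [mirrorCycle, this, if_neg (show ¬ c + 1 ≤ c by omega), if_true]

lemma horBit_mirrorCycle_right {i : Fin P.N} {j : ℕ} (hj : j < c) :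
    (P.mirror (c + 1)).horBit (P.mirrorCycle c a w w') i (2 * c + 1 - j) = P.horBit w' i j := by
  rw [horBit_of_lt _ _ (show 2 * c + 1 - j < 2 * (c + 1) + 1 - 1 by omega)]
  have : foldGap (c + 1) (2 * c + 1 - j) = j := (if_neg (by omega)).trans (by omega)
  simp only [mirrorCycle, this, if_neg hj.ne, if_neg (show ¬ 2 * c + 1 - j ≤ c by omega)]

end

/-- Before the front the conditions are those of `w` and `w'`, and at the front columns they hold by
the choice of `frontParity`. In the mirror column they say that the two parities agree. -/
lemma IsFront.mirrorCycle_mem (h : P.IsFront c a) (hw : w ∈ P.graph.cycles)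
    (hw' : w' ∈ P.graph.cycles) (hww' : ∀ e ∉ P.part c a, w e = w' e) :
    P.mirrorCycle c a w w' ∈ (P.mirror (c + 1)).graph.cycles := by
  rw [mem_cycles_mirror_iff]
  intro i j hj
  have hlt := h.lt
  have hwc := (P.mem_cycles_iff w).mp hw
  have hwc' := (P.mem_cycles_iff w').mp hw'
  rcases lt_trichotomy j (c + 1) with hj1 | rfl | hj1
  · have hf : foldCol (c + 1) j = j := if_pos hj1.le
    rw [hf, vertBit_mirrorCycle_left _ _ (by omega), vertBit_mirrorCycle_left _ _ (by omega)]
    have hprev : (if j = 0 then 0 else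
        (P.mirror (c + 1)).horBit (P.mirrorCycle c a w w') i (j - 1)) =
        if j = 0 then 0 else P.horBit w i (j - 1) := by
      split_ifs with h0
      · rfl
      · exact horBit_mirrorCycle_left _ _ (by omega)
    rw [hprev]
    rcases Nat.lt_succ_iff_lt_or_eq.mp hj1 with hj2 | rfl
    · rw [if_pos (Or.inl hj2), if_pos (Or.inl hj2), horBit_mirrorCycle_left _ _ hj2]
      exact hwc i j (by omega)
    · rw [horBit_mirrorCycle_front]
      simp only [lt_irrefl, false_or, true_and, frontParity]
      generalize (if j = 0 then 0 else P.horBit w i (j - 1)) = s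
      generalize (if i.1 < a then P.vertBit w i j else 0) = p
      generalize (if ((P.below j).symm i).1 < a then P.vertBit w ((P.below j).symm i) j else 0) = q
      revert p q s
      decide
  · rw [vertBit_mirrorCycle_middle, vertBit_mirrorCycle_middle, horBit_mirrorCycle_front',
      if_neg (Nat.succ_ne_zero c), Nat.add_sub_cancel, horBit_mirrorCycle_front,
      h.frontParity_eq hw hw' hww' i, zero_add, zero_add, CharTwo.add_self_eq_zero]
  · obtain ⟨m, hm, rfl⟩ : ∃ m, m ≤ c ∧ j = 2 * (c + 1) - m :=
      ⟨2 * (c + 1) - j, by omega, by omega⟩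
    have hf : foldCol (c + 1) (2 * (c + 1) - m) = m := (if_neg (by omega)).trans (by omega)
    rw [hf, vertBit_mirrorCycle_right _ _ hm, vertBit_mirrorCycle_right _ _ hm,
      if_neg (show ¬ 2 * (c + 1) - m = 0 by omega)]
    have hnext : (P.mirror (c + 1)).horBit (P.mirrorCycle c a w w') i (2 * (c + 1) - m) =
        if m = 0 then 0 else P.horBit w' i (m - 1) := by
      split_ifs with h0
      · exact horBit_of_le _ _ (by simp only; omega)
      · rw [← horBit_mirrorCycle_right w w' (show m - 1 < c by omega)]
        congr 1
        omega
    have hprev : (P.mirror (c + 1)).horBit (P.mirrorCycle c a w w') i (2 * (c + 1) - m - 1) =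
        if m = c then P.frontParity c a w' i else P.horBit w' i m := by
      split_ifs with h0
      · rw [← horBit_mirrorCycle_front' w w']
        congr 1
        omega
      · rw [← horBit_mirrorCycle_right w w' (show m < c by omega)]
        congr 1
        omega
    rw [hnext, hprev]
    rcases hm.lt_or_eq with hm2 | rfl
    · rw [if_pos (Or.inl hm2), if_pos (Or.inl hm2), if_neg hm2.ne]
      linear_combination hwc' i m (by omega)
    · simp only [lt_irrefl, false_or, true_and, if_true, frontParity]
      generalize (if m = 0 then 0 else P.horBit w' i (m - 1)) = s
      generalize (if i.1 < a then P.vertBit w' i m else 0) = p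
      generalize (if ((P.below m).symm i).1 < a then P.vertBit w' ((P.below m).symm i) m else 0) = q
      revert p q s
      decide

/-- A horizontal edge labelled `zero` lies just right of the mirror column in the row of an inner
front vertex, where the parity of `w'` vanishes. -/
lemma IsFront.mirrorCycle_zero (h : P.IsFront c a) (hw' : w' ∈ P.graph.cycles)
    {e' : (P.mirror (c + 1)).Edge} (he' : P.mirrorLab c a e' = .zero) :
    P.mirrorCycle c a w w' e' = 0 := by
  obtain ⟨h1, h2⟩ := mirrorLab_zero.mp he'
  rcases e' with ⟨i, j⟩ | ⟨i, j⟩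
  · exact if_neg (h.not_copy_inl.mp h1)
  · have h3 := h.not_copy_inr.mp h1
    simp only [IsPlus, Classical.not_forall, not_not] at h2
    obtain ⟨h4, h5, h6⟩ := h2
    have hj : j.1 < 2 * (c + 1) + 1 - 1 := j.2
    have h7 : foldGap (c + 1) j = c := by
      unfold foldGap at h3 ⊢
      split_ifs at h3 ⊢ <;> omega
    simp only [mirrorCycle, h7, if_true, if_neg h4.not_ge]
    exact h.frontParity_of_isInner hw' h6 (by omega)

lemma IsFront.mirrorCycle_copyEdge (h : P.IsFront c a) (hw : w ∈ P.graph.cycles)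
    (hw' : w' ∈ P.graph.cycles) {b : Bool} {e : P.Edge} (he : e ∈ P.part c a) :
    P.mirrorCycle c a w w' (P.copyEdge c b e) = if b then w' e else w e := by
  rcases e with ⟨i, j⟩ | ⟨i, j⟩
  · have hm := h.inl_mem.mp he
    rcases b with _ | _
    · rw [apply_copyEdge_false_inl (P.mirrorCycle c a w w') _ _ (by omega), vertBit_mirrorCycle_left _ _ (by omega),
        if_pos hm, vertBit_of_lt w i j.2]
      rfl
    · rw [apply_copyEdge_true_inl (P.mirrorCycle c a w w'), vertBit_mirrorCycle_right _ _ (by omega),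
        if_pos hm, vertBit_of_lt w' i j.2]
      rfl
  · have hm := h.inr_mem.mp he
    rcases b with _ | _
    · rw [apply_copyEdge_false_inr (P.mirrorCycle c a w w') _ _ (by omega)]
      refine Eq.trans ?_ (horBit_of_lt w i j.2)
      rcases hm with hm | ⟨hm, hi⟩
      · rw [horBit_mirrorCycle_left _ _ hm]
      · rw [hm, horBit_mirrorCycle_front, h.frontParity_of_horizontal hw hi]
    · rw [apply_copyEdge_true_inr (P.mirrorCycle c a w w')]
      refine Eq.trans ?_ (horBit_of_lt w' i j.2)
      rcases hm with hm | ⟨hm, hi⟩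
      · rw [horBit_mirrorCycle_right _ _ hm]
      · rw [hm, show 2 * c + 1 - c = c + 1 by omega, horBit_mirrorCycle_front',
          h.frontParity_of_horizontal hw' hi]

end PuncturedCylinder

/-! ### Splitting a boundary of the mirrored graph into two boundaries. -/

namespace PuncturedCylinder

variable {P : PuncturedCylinder} {c a : ℕ}

variable (c) in
/-- The face set that is `s` up to gap `c`, is `m` in gap `c + 1`, and is empty afterwards. -/
def cutFaceSet (s : ℕ → Fin P.N → ZMod 2) (m : Fin P.N → ZMod 2) (g : ℕ) : Fin P.N → ZMod 2 :=
  if g ≤ c then s g else if g = c + 1 then m else 0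

section

variable (s s' : ℕ → Fin P.N → ZMod 2) (m : Fin P.N → ZMod 2)

lemma cutFaceSet_of_le {g : ℕ} (hg : g ≤ c) : cutFaceSet c s m g = s g := if_pos hg

lemma cutFaceSet_succ : cutFaceSet c s m (c + 1) = m := by
  simp [cutFaceSet]

lemma cutFaceSet_of_lt {g : ℕ} (hg : c + 1 < g) : cutFaceSet c s m g = 0 := by
  rw [cutFaceSet, if_neg (by omega), if_neg (by omega)]

lemma cutFaceSet_congr {g : ℕ} (hg : c < g) : cutFaceSet c s m g = cutFaceSet c s' m g := by
  simp only [cutFaceSet, if_neg hg.not_ge]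

variable {s m}

/-- Each face condition involves a single gap, so a face set may be changed gap by gap. Gap `c + 1`
is an end cap if `c` is the last column, and `m` must then be constant. -/
lemma isFaceSet_cutFaceSet (hc : c < P.M)
    (h1 : ∀ j, j + 1 ≤ c → ∀ i,
      s (j + 1) ((P.below j).symm i) = s (j + 1) ((P.below (j + 1)).symm i))
    (h0 : ∀ i, s 0 ((P.below 0).symm i) = s 0 i)
    (hm : c + 1 < P.M → ∀ i, m ((P.below c).symm i) = m ((P.below (c + 1)).symm i))
    (hm' : c + 1 = P.M → ∀ i i', m i = m i') : P.IsFaceSet (cutFaceSet c s m) := by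
  refine ⟨fun j hj i => ?_, fun i => ?_, fun i => ?_⟩
  · rcases lt_trichotomy j c with hjc | rfl | hjc
    · rw [cutFaceSet_of_le _ _ (by omega)]
      exact h1 j hjc i
    · rw [cutFaceSet_succ]
      exact hm hj i
    · rw [cutFaceSet_of_lt _ _ (by omega)]
      rfl
  · rw [cutFaceSet_of_le _ _ (Nat.zero_le c)]
    exact h0 i
  · by_cases hcM : c + 1 = P.M
    · rw [← hcM, cutFaceSet_succ]
      exact hm' hcM _ _
    · rw [cutFaceSet_of_lt _ _ (by omega)]
      rfl

end

/-- A boundary in the mirrored graph that avoids the edges labelled `zero` consists of the measured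
parts of two boundaries that agree on the other edges. -/
lemma IsFront.exists_boundary (h : P.IsFront c a) {z : (P.mirror (c + 1)).Edge → ZMod 2}
    (hz : z ∈ (P.mirror (c + 1)).graph.cycles) (hzb : z ∈ (P.mirror (c + 1)).graph.boundaries)
    (hz0 : ∀ e', P.mirrorLab c a e' = .zero → z e' = 0) :
    ∃ u ∈ P.graph.boundaries, ∃ u' ∈ P.graph.boundaries, (∀ e ∉ P.part c a, u e = u' e) ∧
      (∀ e ∈ P.part c a, u e = z (P.copyEdge c false e)) ∧
      ∀ e ∈ P.part c a, u' e = z (P.copyEdge c true e) := by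
  have hlt := h.lt
  have hlast := h.last
  obtain ⟨s, ⟨hs1, hs0, hsM⟩, hzs⟩ : ∃ s : ℕ → Fin P.N → ZMod 2,
    (P.mirror (c + 1)).IsFaceSet s ∧ z = (P.mirror (c + 1)).bdryOf s := exists_eq_bdryOf _ hzb
  have hvert : ∀ (i : Fin P.N) j, j ≤ 2 * (c + 1) →
      (P.mirror (c + 1)).vertBit z i j = s j i + s (j + 1) i := by
    intro i j hj
    rw [vertBit_of_lt _ _ (show j < 2 * (c + 1) + 1 by omega), hzs]
    rfl
  have hface : ∀ (i : Fin P.N) j, j < 2 * (c + 1) → s (j + 1) ((P.below (foldCol (c + 1) j)).symm i) =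
      s (j + 1) ((P.below (foldCol (c + 1) (j + 1))).symm i) := by
    intro i j hj
    rw [← P.below_mirror (by omega), ← P.below_mirror (by omega)]
    exact hs1 j (by simp only; omega) i
  have hhor : ∀ (i : Fin P.N) j, j < 2 * (c + 1) → (P.mirror (c + 1)).horBit z i j =
      s (j + 1) i + s (j + 1) ((P.below (foldCol (c + 1) j)).symm i) := by
    intro i j hj
    rw [horBit_of_lt _ _ (show j < 2 * (c + 1) + 1 - 1 by omega), hzs,
      ← P.below_mirror (by omega)]
    rfl
  have hleft : ∀ j, j ≤ c + 1 → foldCol (c + 1) j = j := fun j hj => if_pos hj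
  have hright : ∀ j, j ≤ c → foldCol (c + 1) (2 * (c + 1) - j) = j :=
    fun j hj => (if_neg (by omega)).trans (by omega)
  have eq_of : ∀ p q : ZMod 2, p + q = 0 → p = q := by decide
  -- All vertical edges of the mirror column vanish, so the face sets on its two sides coincide.
  have hmid : s (c + 2) = s (c + 1) := by
    funext i
    have := h.vertBit_eq_zero hz hz0 (i := i) (j := c + 1) (by omega)
      (by rw [hleft _ le_rfl]; omega)
    rw [hvert _ _ (by omega)] at this
    exact (eq_of _ _ this).symm
  have hunm : ∀ i : Fin P.N, a ≤ i.1 → s c i = s (c + 3) i := by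
    intro i hi
    have h1 := h.vertBit_eq_zero hz hz0 (i := i) (j := c) (by omega)
      (by rw [hleft _ (by omega)]; omega)
    have h2 := h.vertBit_eq_zero hz hz0 (i := i) (j := 2 * (c + 1) - c) (by omega)
      (by rw [hright _ le_rfl]; omega)
    rw [hvert _ _ (by omega)] at h1 h2
    rw [show 2 * (c + 1) - c = c + 2 by omega, hmid] at h2
    exact (eq_of _ _ h1).trans (eq_of _ _ h2)
  have hN := P.rows
  -- Past the last column of `P` there is a single cap face, while the gap of the mirrored graph has
  -- one face per row. The value in row 0 is taken for the cap; it needs to be right only in rows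
  -- whose vertical edge is measured.
  let m : Fin P.N → ZMod 2 := if c + 1 < P.M then s (c + 1) else fun _ => s (c + 1) ⟨0, by omega⟩
  have hm : c + 1 < P.M → m = s (c + 1) := fun hc => if_pos hc
  have hma : ∀ i : Fin P.N, i.1 < a → m i = s (c + 1) i := by
    by_cases hc : c + 1 < P.M
    · exact fun i _ => by rw [hm hc]
    · have hcM : c + 1 = P.M := by omega
      have hm0 : m = fun _ => s (c + 1) ⟨0, by omega⟩ := if_neg hc
      -- In rows `1, …, a - 1` the front vertex is inner, so the horizontal edge right of the mirror
      -- column is labelled `zero` and the faces above and below it have equal bits.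
      have key : ∀ n (hn : n < P.N), n < a → s (c + 1) ⟨0, by omega⟩ = s (c + 1) ⟨n, hn⟩ := by
        intro n
        induction n with
        | zero => exact fun _ _ => rfl
        | succ n ih =>
          intro hn hna
          rw [ih (by omega) (by omega)]
          have hinner : P.IsInner c a (⟨n + 1, hn⟩, ⟨c, hlt⟩) :=
            h.isInner_of_last hcM rfl (Nat.succ_pos n) hna
          have hlab : P.mirrorLab c a (.inr (⟨n + 1, hn⟩, ⟨c + 1, by simp only; omega⟩)) = .zero := by
            refine mirrorLab_zero.mpr ⟨h.not_copy_inr.mpr ?_, fun hp =>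
              hp (Nat.lt_succ_self c) hlt hinner⟩
            have : foldGap (c + 1) (c + 1) = c := (if_neg (by omega)).trans (by omega)
            simp only [this]
            have := hlast hcM
            omega
          have h1 := hz0 _ hlab
          have h2 := hhor ⟨n + 1, hn⟩ (c + 1) (by omega)
          rw [horBit_of_lt _ _ (show c + 1 < 2 * (c + 1) + 1 - 1 by omega), h1, hleft _ le_rfl,
            hmid] at h2
          have hb : (P.below (c + 1)).symm ⟨n + 1, hn⟩ = ⟨n, by omega⟩ :=
            Fin.ext (P.below_symm_val (P.cut_of_last_le (by omega)) (Nat.succ_pos _))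
          rw [hb] at h2
          exact (eq_of _ _ h2.symm).symm
      intro i hi
      rw [hm0]
      exact key i.1 i.2 hi
  -- There is one more gap than there are columns, hence the `+ 1` in the reflection.
  let s' : ℕ → Fin P.N → ZMod 2 := fun g => s (2 * (c + 1) + 1 - g)
  have hmface : c + 1 < P.M → ∀ i, m ((P.below c).symm i) = m ((P.below (c + 1)).symm i) := by
    intro hc i
    have := hface i c (by omega)
    rwa [hleft _ (by omega), hleft _ le_rfl, ← hm hc] at this
  have hmconst : c + 1 = P.M → ∀ i i', m i = m i' := fun hc i i' => by
    have hm0 : m = fun _ => s (c + 1) ⟨0, by omega⟩ := if_neg (by omega)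
    rw [hm0]
  refine ⟨P.bdryOf (cutFaceSet c s m), P.bdryOf_mem_boundaries ?_,
    P.bdryOf (cutFaceSet c s' m), P.bdryOf_mem_boundaries ?_, ?_, ?_, ?_⟩
  · refine isFaceSet_cutFaceSet hlt (fun j hj i => ?_) (fun i => ?_) hmface hmconst
    · have := hface i j (by omega)
      rwa [hleft _ (by omega), hleft _ (by omega)] at this
    · have := hs0 i
      rwa [P.below_mirror (by omega)] at this
  · refine isFaceSet_cutFaceSet hlt (fun j hj i => ?_) (fun i => ?_) hmface hmconst
    · have := hface i (2 * (c + 1) - (j + 1)) (by omega)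
      rw [hright _ (by omega), show 2 * (c + 1) - (j + 1) + 1 = 2 * (c + 1) - j by omega,
        hright _ (by omega)] at this
      simp only [s']
      rw [show 2 * (c + 1) + 1 - (j + 1) = 2 * (c + 1) - j by omega]
      exact this.symm
    · have := hsM i
      simp only [Nat.add_sub_cancel] at this
      rw [P.below_mirror le_rfl, show foldCol (c + 1) (2 * (c + 1)) = 0 from
        hright 0 (Nat.zero_le c)] at this
      exact this
  -- The two face sets differ only in gaps up to `c`. The only unmeasured edges bordering these are
  -- vertical edges of column `c`, which are covered by `hunm`.
  · rintro (⟨i, j⟩ | ⟨i, j⟩) he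
    · rw [h.inl_mem] at he
      simp only [bdryOf]
      rw [cutFaceSet_congr s s' m (by omega : c < j.1 + 1)]
      by_cases hj : j.1 = c
      · rw [hj, cutFaceSet_of_le _ _ le_rfl, cutFaceSet_of_le _ _ le_rfl, hunm i (by omega)]
        simp only [s', show 2 * (c + 1) + 1 - c = c + 3 by omega]
      · rw [cutFaceSet_congr s s' m (by omega : c < j.1)]
    · rw [h.inr_mem] at he
      simp only [bdryOf]
      rw [cutFaceSet_congr s s' m (by omega : c < j.1 + 1)]
  · rintro (⟨i, j⟩ | ⟨i, j⟩) he
    · rw [h.inl_mem] at he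
      rw [apply_copyEdge_false_inl z _ _ (by omega), hvert _ _ (by omega)]
      simp only [bdryOf]
      rw [cutFaceSet_of_le _ _ (by omega)]
      rcases he with hj | ⟨hj, hi⟩
      · rw [cutFaceSet_of_le _ _ (by omega)]
      · rw [hj, cutFaceSet_succ, hma i hi]
    · rw [h.inr_mem] at he
      have := j.2
      rw [apply_copyEdge_false_inr z _ _ (by omega), hhor _ _ (by omega), hleft _ (by omega)]
      simp only [bdryOf]
      rcases he with hj | ⟨hj, hi⟩
      · rw [cutFaceSet_of_le _ _ (by omega)]
      · rw [hj, cutFaceSet_succ, hm (by omega)]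
  · rintro (⟨i, j⟩ | ⟨i, j⟩) he
    · rw [h.inl_mem] at he
      rw [apply_copyEdge_true_inl z, hvert _ _ (by omega)]
      simp only [bdryOf]
      rw [cutFaceSet_of_le _ _ (by omega), add_comm]
      simp only [s', show 2 * (c + 1) + 1 - j.1 = 2 * (c + 1) - j.1 + 1 by omega]
      congr 1
      rcases he with hj | ⟨hj, hi⟩
      · rw [cutFaceSet_of_le _ _ (by omega)]
        simp only [show 2 * (c + 1) + 1 - (j.1 + 1) = 2 * (c + 1) - j.1 by omega]
      · rw [hj, cutFaceSet_succ, hma i hi, show 2 * (c + 1) - c = c + 2 by omega, hmid]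
    · rw [h.inr_mem] at he
      have := j.2
      rw [apply_copyEdge_true_inr z, hhor _ _ (by omega), hface _ _ (by omega),
        show 2 * c + 1 - j.1 + 1 = 2 * (c + 1) - j.1 by omega, hright _ (by omega)]
      simp only [bdryOf]
      rcases he with hj | ⟨hj, hi⟩
      · rw [cutFaceSet_of_le _ _ (by omega)]
        simp only [s', show 2 * (c + 1) + 1 - (j.1 + 1) = 2 * (c + 1) - j.1 by omega]
      · rw [hj, cutFaceSet_succ, hm (by omega), show 2 * (c + 1) - c = c + 2 by omega, hmid]

lemma IsFront.represents (h : P.IsFront c a) : P.graph.Represents (P.part c a)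
    (P.mirror (c + 1)).graph (P.mirrorLab c a) (fun e => P.copyEdge c false e)
    fun e => P.copyEdge c true e where
  lab_fst := h.mirrorLab_fst
  lab_snd := h.mirrorLab_snd
  eq_zero z hz hz0 h1 h2 := h.eq_zero hz hz0 fun b e he => by
    cases b
    exacts [h1 ⟨e, he⟩, h2 ⟨e, he⟩]
  exists_cycle w hw w' hw' hww' := ⟨P.mirrorCycle c a w w', h.mirrorCycle_mem hw hw' hww',
    fun e' he' => h.mirrorCycle_zero hw' he', fun e => h.mirrorCycle_copyEdge hw hw' e.2,
    fun e => h.mirrorCycle_copyEdge hw hw' e.2⟩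
  exists_boundary z hz hzb hz0 := by
    obtain ⟨u, hu, u', hu', h1, h2, h3⟩ := h.exists_boundary hz hzb hz0
    exact ⟨u, hu, u', hu', h1, fun e => h2 e e.2, fun e => h3 e e.2⟩

end PuncturedCylinder

/-! ### Contracting the mirrored graph to the doubled graph. -/

namespace EmbeddedGraph

lemma copyVertex_val {V E : Type} (G : EmbeddedGraph V E) (S : Finset E) (b : Bool) (v : V)
    (hv : v ∈ G.touched S) :
    (G.copyVertex S b v hv).1 = (v, if v ∈ G.boundary S then false else b) := by
  unfold copyVertex
  split_ifs <;> rfl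

end EmbeddedGraph

namespace PuncturedCylinder

variable {P : PuncturedCylinder} {c a : ℕ}

lemma mem_boundary_iff {v : P.Vertex} : v ∈ P.graph.boundary (P.part c a) ↔
    v ∈ P.graph.touched (P.part c a) ∧ ¬ P.IsInner c a v := by
  refine and_congr_right fun _ => ?_
  simp only [IsInner, Classical.not_forall]
  exact exists_congr fun e => ⟨fun h => ⟨h.2, h.1⟩, fun ⟨h1, h2⟩ => ⟨h2, h1⟩⟩

lemma IsInner.mem_touched {v : P.Vertex} (hv : P.IsInner c a v) :
    v ∈ P.graph.touched (P.part c a) :=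
  ⟨.inl v, hv _ (Or.inl rfl), Or.inl rfl⟩

lemma IsFront.isInner_le (h : P.IsFront c a) {v : P.Vertex} (hv : P.IsInner c a v) :
    v.2.1 ≤ c := by
  have := h.inl_mem.mp (hv (.inl v) (Or.inl rfl))
  omega

/-- If `c > 0`, measured horizontal edges reach every vertex of the front column. If `c = 0`, only
vertical edges can do so, and the last one measured ends in row `a` unless it wraps around. -/
lemma IsFront.mem_touched_iff (h : P.IsFront c a) {i : Fin P.N} {j : Fin P.M} :
    (i, j) ∈ P.graph.touched (P.part c a) ↔
      (j.1 ≤ c ∧ (c = 0 → i.1 ≤ a)) ∨ (j.1 = c + 1 ∧ P.N + i.1 < a) := by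
  have hpos := h.pos
  constructor
  · rintro ⟨⟨i', j'⟩ | ⟨i', j'⟩, he, hi | hi⟩
    · have hm := h.inl_mem.mp he
      obtain ⟨h1, h2⟩ : i' = i ∧ j' = j := Prod.mk.inj hi
      subst h1 h2
      omega
    · have hm := h.inl_mem.mp he
      obtain ⟨h1, h2⟩ : P.below j'.1 i' = i ∧ j' = j := Prod.mk.inj hi
      subst h2
      refine Or.inl ⟨by omega, ?_⟩
      rintro rfl
      have hj : j'.1 = 0 := by omega
      by_cases hlast : i'.1 + 1 < P.N
      · have := P.below_val (hj ▸ P.cut_zero : P.cut j'.1 = 0) hlast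
        rw [h1] at this
        omega
      · have := i.2
        have := i'.2
        omega
    · have hm := h.inr_mem.mp he
      have h1 : i' = i := congrArg Prod.fst hi
      have h2 : j'.1 = j.1 := congrArg (fun v => v.2.1) hi
      subst h1
      omega
    · have hm := h.inr_mem.mp he
      have h1 : i' = i := congrArg Prod.fst hi
      have h2 : j'.1 + 1 = j.1 := congrArg (fun v => v.2.1) hi
      subst h1
      omega
  · have hj := j.2
    have hiN := i.2
    rintro (⟨h1, h2⟩ | ⟨h1, h2⟩)
    · by_cases hj0 : j.1 = 0
      · by_cases hm : j.1 < c ∨ (j.1 = c ∧ i.1 < a)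
        · exact ⟨.inl (i, j), h.inl_mem.mpr hm, Or.inl rfl⟩
        · have hi : a - 1 < P.N := by omega
          refine ⟨.inl (⟨a - 1, hi⟩, j), h.inl_mem.mpr (Or.inr ⟨by omega, by simp only; omega⟩),
            Or.inr (Prod.ext (Fin.ext ?_) rfl)⟩
          have := P.below_val (i := ⟨a - 1, hi⟩) (hj0 ▸ P.cut_zero : P.cut j.1 = 0)
            (by simp only; omega)
          refine this.trans ?_
          simp only
          omega
      · refine ⟨.inr (i, ⟨j.1 - 1, by omega⟩), h.inr_mem.mpr (Or.inl (by simp only; omega)),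
          Or.inr (Prod.ext rfl (Fin.ext ?_))⟩
        change j.1 - 1 + 1 = j.1
        omega
    · exact ⟨.inr (i, ⟨c, by omega⟩), h.inr_mem.mpr (Or.inr ⟨rfl, h2⟩),
        Or.inr (Prod.ext rfl (Fin.ext h1.symm))⟩

variable (P c a) in
/-- Untouched vertices are contracted to the last touched row. -/
def clampRow (i : Fin P.N) : Fin P.N :=
  if c = 0 then ⟨min i.1 a, by have := i.2; omega⟩ else i

lemma clampRow_of_touched {i : Fin P.N} (hi : c = 0 → i.1 ≤ a) : P.clampRow c a i = i := by
  unfold clampRow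
  split_ifs with h0
  · exact Fin.ext (min_eq_left (hi h0))
  · rfl

lemma clampRow_le (hc : c = 0) (i : Fin P.N) : (P.clampRow c a i).1 ≤ a := by
  rw [clampRow, if_pos hc]
  exact min_le_right _ _

variable (P c) in
/-- The copy (`false`) or mirror image (`true`) of a vertex. -/
def copyPos : Bool → P.Vertex → (P.mirror (c + 1)).Vertex
  | false, (i, j) => (i, ⟨min j.1 (2 * (c + 1)), by simp only; omega⟩)
  | true, (i, j) => (i, ⟨2 * (c + 1) - j.1, by simp only; omega⟩)

/-- The vertex of the doubled graph, with the number of its copy, to which a vertex of the mirrored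
graph is contracted. -/
noncomputable def contractPos (h : P.IsFront c a) (w : (P.mirror (c + 1)).Vertex) :
    P.Vertex × Bool :=
  if hj : w.2.1 ≤ c then ((P.clampRow c a w.1, ⟨w.2.1, hj.trans_lt h.lt⟩), false)
  else if hj' : w.2.1 = c + 1 then
    -- If the horizontal edge is measured, its right end is a boundary vertex and the mirror column
    -- carries its only copy.
    if hc : c + 1 < P.M ∧ P.N + w.1.1 < a then ((w.1, ⟨c + 1, hc.1⟩), false)
    else ((P.clampRow c a w.1, ⟨c, h.lt⟩), false)
  else if P.IsInner c a (w.1, ⟨2 * (c + 1) - w.2.1, by have := h.lt; omega⟩) then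
    ((w.1, ⟨2 * (c + 1) - w.2.1, by have := h.lt; omega⟩), true)
  else ((P.clampRow c a w.1, ⟨2 * (c + 1) - w.2.1, by have := h.lt; omega⟩), false)

section

variable (h : P.IsFront c a) {i : Fin P.N} {j : Fin (2 * (c + 1) + 1)}

lemma IsFront.contractPos_left (hj : j.1 ≤ c) :
    contractPos h (i, j) = ((P.clampRow c a i, ⟨j.1, hj.trans_lt h.lt⟩), false) := dif_pos hj

lemma IsFront.contractPos_middle (hj : j.1 = c + 1) (hc : c + 1 < P.M ∧ P.N + i.1 < a) :
    contractPos h (i, j) = ((i, ⟨c + 1, hc.1⟩), false) := by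
  have hj' : ¬ j.1 ≤ c := by omega
  simp only [contractPos, dif_neg hj', dif_pos hj, dif_pos hc]

lemma IsFront.contractPos_middle' (hj : j.1 = c + 1) (hc : ¬ (c + 1 < P.M ∧ P.N + i.1 < a)) :
    contractPos h (i, j) = ((P.clampRow c a i, ⟨c, h.lt⟩), false) := by
  have hj' : ¬ j.1 ≤ c := by omega
  simp only [contractPos, dif_neg hj', dif_pos hj, dif_neg hc]

lemma IsFront.contractPos_right (hj : c + 1 < j.1) {m : Fin P.M} (hm : m.1 = 2 * (c + 1) - j.1)
    (hi : P.IsInner c a (i, m)) : contractPos h (i, j) = ((i, m), true) := by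
  obtain ⟨m, hmM⟩ := m
  simp only at hm
  subst hm
  simp only [contractPos, dif_neg (show ¬ j.1 ≤ c by omega),
    dif_neg (show ¬ j.1 = c + 1 by omega), if_pos hi]

lemma IsFront.contractPos_right' (hj : c + 1 < j.1) {m : Fin P.M} (hm : m.1 = 2 * (c + 1) - j.1)
    (hi : ¬ P.IsInner c a (i, m)) :
    contractPos h (i, j) = ((P.clampRow c a i, m), false) := by
  obtain ⟨m, hmM⟩ := m
  simp only at hm
  subst hm
  simp only [contractPos, dif_neg (show ¬ j.1 ≤ c by omega),
    dif_neg (show ¬ j.1 = c + 1 by omega), if_neg hi]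

end

lemma IsFront.clampRow_touched (h : P.IsFront c a) (i : Fin P.N) {j : Fin P.M} (hj : j.1 ≤ c) :
    (P.clampRow c a i, j) ∈ P.graph.touched (P.part c a) :=
  h.mem_touched_iff.mpr (Or.inl ⟨hj, fun hc => clampRow_le hc i⟩)

lemma IsFront.contractPos_mem (h : P.IsFront c a) (w : (P.mirror (c + 1)).Vertex) :
    (contractPos h w).1 ∈ P.graph.touched (P.part c a) ∧
      ((contractPos h w).1 ∈ P.graph.boundary (P.part c a) → (contractPos h w).2 = false) := by
  obtain ⟨i, j⟩ := w
  have hlt := h.lt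
  by_cases hj : j.1 ≤ c
  · rw [h.contractPos_left hj]
    exact ⟨h.clampRow_touched i hj, fun _ => rfl⟩
  by_cases hj' : j.1 = c + 1
  · by_cases hc : c + 1 < P.M ∧ P.N + i.1 < a
    · rw [h.contractPos_middle hj' hc]
      exact ⟨h.mem_touched_iff.mpr (Or.inr ⟨rfl, hc.2⟩), fun _ => rfl⟩
    · rw [h.contractPos_middle' hj' hc]
      exact ⟨h.clampRow_touched i le_rfl, fun _ => rfl⟩
  · obtain ⟨m, hm⟩ : ∃ m : Fin P.M, m.1 = 2 * (c + 1) - j.1 :=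
      ⟨⟨2 * (c + 1) - j.1, by omega⟩, rfl⟩
    by_cases hi : P.IsInner c a (i, m)
    · rw [h.contractPos_right (by omega) hm hi]
      exact ⟨hi.mem_touched, fun hb => absurd hi (mem_boundary_iff.mp hb).2⟩
    · rw [h.contractPos_right' (by omega) hm hi]
      exact ⟨h.clampRow_touched i (by omega), fun _ => rfl⟩

/-- Contraction undoes copying. -/
lemma IsFront.contractPos_copyPos (h : P.IsFront c a) (b : Bool) {v : P.Vertex}
    (hv : v ∈ P.graph.touched (P.part c a)) : contractPos h (P.copyPos c b v) =
      (v, if v ∈ P.graph.boundary (P.part c a) then false else b) := by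
  obtain ⟨i, j⟩ := v
  have hj := j.2
  rcases h.mem_touched_iff.mp hv with ⟨h1, h2⟩ | ⟨h1, h2⟩
  · have hcl := clampRow_of_touched h2
    rcases b with _ | _
    · have hmin : min j.1 (2 * (c + 1)) = j.1 := min_eq_left (by omega)
      refine (h.contractPos_left (hmin.trans_le h1)).trans ?_
      simp only [hcl, hmin, Fin.eta, ite_self]
    · have hm : j.1 = 2 * (c + 1) - (2 * (c + 1) - j.1) := by omega
      by_cases hi : P.IsInner c a (i, j)
      · refine (h.contractPos_right (by simp only; omega) hm hi).trans ?_
        rw [if_neg fun hb => (mem_boundary_iff.mp hb).2 hi]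
      · refine (h.contractPos_right' (by simp only; omega) hm hi).trans ?_
        rw [if_pos (mem_boundary_iff.mpr ⟨hv, hi⟩), hcl]
  · have hb : (i, j) ∈ P.graph.boundary (P.part c a) := mem_boundary_iff.mpr ⟨hv, fun hi => by
      have := h.isInner_le hi
      simp only at this
      omega⟩
    have hje : (⟨c + 1, by omega⟩ : Fin P.M) = j := Fin.ext h1.symm
    rw [if_pos hb]
    rcases b with _ | _
    · refine (h.contractPos_middle (by simp only; omega) ⟨by omega, h2⟩).trans ?_
      rw [hje]
    · refine (h.contractPos_middle (by simp only; omega) ⟨by omega, h2⟩).trans ?_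
      rw [hje]

/-- The vertices of the mirrored graph that are contracted to another vertex. -/
lemma IsFront.copyPos_contractPos_ne_iff (h : P.IsFront c a) {i : Fin P.N}
    {j : Fin (2 * (c + 1) + 1)} :
    P.copyPos c (contractPos h (i, j)).2 (contractPos h (i, j)).1 ≠ (i, j) ↔
      (j.1 ≤ c ∧ c = 0 ∧ a < i.1) ∨ (j.1 = c + 1 ∧ ¬ (c + 1 < P.M ∧ P.N + i.1 < a)) ∨
        (j.1 = c + 2 ∧ ¬ P.IsInner c a (i, ⟨c, h.lt⟩)) := by
  have hlt := h.lt
  have hj2 := j.2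
  by_cases hj : j.1 ≤ c
  · rw [h.contractPos_left hj]
    have h1 : P.copyPos c false (P.clampRow c a i, ⟨j.1, hj.trans_lt h.lt⟩) =
        (P.clampRow c a i, j) := Prod.ext rfl (Fin.ext (min_eq_left (by simp only; omega)))
    rw [h1]
    constructor
    · intro hne
      refine Or.inl ⟨hj, ?_⟩
      by_contra hn
      exact hne (Prod.ext (clampRow_of_touched fun hc => by omega) rfl)
    · rintro (⟨-, hc, hi⟩ | h2 | h2) heq
      · have h3 : P.clampRow c a i = i := congrArg Prod.fst heq
        have := clampRow_le (a := a) hc i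
        rw [h3] at this
        omega
      · omega
      · omega
  by_cases hj' : j.1 = c + 1
  · by_cases hc : c + 1 < P.M ∧ P.N + i.1 < a
    · rw [h.contractPos_middle hj' hc]
      refine iff_of_false (fun hne => hne (Prod.ext rfl (Fin.ext ?_))) (by omega)
      refine (min_eq_left ?_).trans hj'.symm
      simp only
      omega
    · rw [h.contractPos_middle' hj' hc]
      refine iff_of_true (fun heq => ?_) (Or.inr (Or.inl ⟨hj', hc⟩))
      have h1 : min c (2 * (c + 1)) = j.1 := congrArg (fun v => v.2.1) heq
      omega
  · obtain ⟨m, hm⟩ : ∃ m : Fin P.M, m.1 = 2 * (c + 1) - j.1 :=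
      ⟨⟨2 * (c + 1) - j.1, by omega⟩, rfl⟩
    by_cases hi : P.IsInner c a (i, m)
    · rw [h.contractPos_right (by omega) hm hi]
      refine iff_of_false (fun hne => hne (Prod.ext rfl (Fin.ext ?_))) ?_
      · change 2 * (c + 1) - m.1 = j.1
        omega
      · rintro (h1 | h1 | ⟨h1, h2⟩)
        · omega
        · omega
        · refine h2 ?_
          have : m = ⟨c, h.lt⟩ := Fin.ext (by simp only; omega)
          rwa [← this]
    · rw [h.contractPos_right' (by omega) hm hi]
      -- Vertices before the front column are inner, so gluing occurs in column `c` only.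
      have hmc : m = ⟨c, h.lt⟩ := Fin.ext (by
        by_contra hmc
        simp only at hmc
        exact hi (h.isInner_of_lt (by omega)))
      have hmc' : m.1 = c := congrArg Fin.val hmc
      refine iff_of_true (fun heq => ?_) (Or.inr (Or.inr ⟨by omega, hmc ▸ hi⟩))
      have h1 : min m.1 (2 * (c + 1)) = j.1 := congrArg (fun v => v.2.1) heq
      omega

lemma src_copyEdge_inl (b : Bool) {i : Fin P.N} {j : Fin P.M} (hj : j.1 ≤ c) (d : Bool) :
    (P.mirror (c + 1)).src (P.copyEdge c b (.inl (i, j)), d) =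
      P.copyPos c b (P.src (.inl (i, j), d)) := by
  rcases b with _ | _ <;> rcases d with _ | _
  · rfl
  · have h1 : min j.1 (2 * (c + 1)) = j.1 := min_eq_left (by omega)
    refine Prod.ext ?_ rfl
    change (P.mirror (c + 1)).below (min j.1 (2 * (c + 1))) i = P.below j.1 i
    rw [h1, P.below_mirror (by omega), foldCol, if_pos (by omega)]
  · rfl
  · refine Prod.ext ?_ rfl
    change (P.mirror (c + 1)).below (2 * (c + 1) - j.1) i = P.below j.1 i
    rw [P.below_mirror (by omega), foldCol, if_neg (by omega)]
    congr 2
    omega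

/-- Reflection exchanges left and right ends, hence the `xor`; vertical edges keep their direction.
-/
lemma src_copyEdge_inr (b : Bool) {i : Fin P.N} {j : Fin (P.M - 1)} (hj : j.1 ≤ c) (d : Bool) :
    (P.mirror (c + 1)).src (P.copyEdge c b (.inr (i, j)), d) =
      P.copyPos c b (P.src (.inr (i, j), xor b d)) := by
  rcases b with _ | _ <;> rcases d with _ | _ <;> refine Prod.ext rfl (Fin.ext ?_)
  · change min j.1 (2 * c + 1) = min j.1 (2 * (c + 1))
    omega
  · change min j.1 (2 * c + 1) + 1 = min (j.1 + 1) (2 * (c + 1))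
    omega
  · change 2 * c + 1 - j.1 = 2 * (c + 1) - (j.1 + 1)
    omega
  · change 2 * c + 1 - j.1 + 1 = 2 * (c + 1) - j.1
    omega

/-- The contraction of vertices as a map to the doubled graph. -/
noncomputable def contractVertex (h : P.IsFront c a) (w : (P.mirror (c + 1)).Vertex) :
    P.graph.DoubleVertex (P.part c a) := ⟨contractPos h w, h.contractPos_mem w⟩

lemma IsFront.contractVertex_copyPos (h : P.IsFront c a) (b : Bool) {v : P.Vertex}
    (hv : v ∈ P.graph.touched (P.part c a)) :
    contractVertex h (P.copyPos c b v) = P.graph.copyVertex _ b v hv :=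
  Subtype.ext ((h.contractPos_copyPos b hv).trans (P.graph.copyVertex_val _ b v hv).symm)

variable (P c) in
/-- The end of a contracted edge that remains. -/
def parent (w : (P.mirror (c + 1)).Vertex) : (P.mirror (c + 1)).Vertex :=
  if w.2.1 ≤ c then (⟨w.1.1 - 1, (Nat.sub_le _ _).trans_lt w.1.2⟩, w.2)
  else if w.2.1 = c + 1 then (w.1, ⟨c, by simp only; omega⟩)
  else (w.1, ⟨c + 1, by simp only; omega⟩)

variable (P c) in
/-- The edge to the parent of a vertex. -/
def parentEdge (w : (P.mirror (c + 1)).Vertex) : (P.mirror (c + 1)).Edge :=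
  if w.2.1 ≤ c then .inl (⟨w.1.1 - 1, (Nat.sub_le _ _).trans_lt w.1.2⟩, w.2)
  else if w.2.1 = c + 1 then .inr (w.1, ⟨c, by simp only; omega⟩)
  else .inr (w.1, ⟨c + 1, by simp only; omega⟩)

variable (P c) in
/-- The height of a vertex in the contracted forest. -/
def height (w : (P.mirror (c + 1)).Vertex) : ℕ :=
  if w.2.1 ≤ c then w.1.1 else if w.2.1 = c + 1 then P.N else P.N + 1

end PuncturedCylinder

namespace PuncturedCylinder

variable {P : PuncturedCylinder} {c a : ℕ}

section

variable {i : Fin P.N} {j : Fin (2 * (c + 1) + 1)}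

lemma parent_left (hj : j.1 ≤ c) :
    P.parent c (i, j) = (⟨i.1 - 1, (Nat.sub_le _ _).trans_lt i.2⟩, j) := if_pos hj

lemma parent_middle (hj : j.1 = c + 1) : P.parent c (i, j) = (i, ⟨c, by simp only; omega⟩) :=
  (if_neg (by simp only; omega)).trans (if_pos hj)

lemma parent_right (hj : j.1 = c + 2) : P.parent c (i, j) = (i, ⟨c + 1, by simp only; omega⟩) :=
  (if_neg (by simp only; omega)).trans (if_neg (by simp only; omega))

lemma parentEdge_left (hj : j.1 ≤ c) :
    P.parentEdge c (i, j) = .inl (⟨i.1 - 1, (Nat.sub_le _ _).trans_lt i.2⟩, j) := if_pos hj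

lemma parentEdge_middle (hj : j.1 = c + 1) :
    P.parentEdge c (i, j) = .inr (i, ⟨c, by simp only; omega⟩) :=
  (if_neg (by simp only; omega)).trans (if_pos hj)

lemma parentEdge_right (hj : j.1 = c + 2) :
    P.parentEdge c (i, j) = .inr (i, ⟨c + 1, by simp only; omega⟩) :=
  (if_neg (by simp only; omega)).trans (if_neg (by simp only; omega))

end

variable (P c a) in
/-- The vertices that are contracted to their parents. -/
def IsContracted (w : (P.mirror (c + 1)).Vertex) : Prop :=
  (w.2.1 ≤ c ∧ c = 0 ∧ a < w.1.1) ∨ (w.2.1 = c + 1 ∧ ¬ (c + 1 < P.M ∧ P.N + w.1.1 < a)) ∨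
    (w.2.1 = c + 2 ∧ ∀ hc : c < P.M, ¬ P.IsInner c a (w.1, ⟨c, hc⟩))

lemma IsFront.isContracted_iff (h : P.IsFront c a) {w : (P.mirror (c + 1)).Vertex} :
    P.copyPos c (contractPos h w).2 (contractPos h w).1 ≠ w ↔ P.IsContracted c a w := by
  obtain ⟨i, j⟩ := w
  refine h.copyPos_contractPos_ne_iff.trans ?_
  simp only [IsContracted, h.lt, forall_true_left]

lemma IsContracted.parentEdge_inj {w w' : (P.mirror (c + 1)).Vertex} (hw : P.IsContracted c a w)
    (hw' : P.IsContracted c a w') (heq : P.parentEdge c w = P.parentEdge c w') : w = w' := by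
  obtain ⟨i, j⟩ := w
  obtain ⟨i', j'⟩ := w'
  rcases hw with ⟨hj, hw⟩ | ⟨hj, hw⟩ | ⟨hj, hw⟩ <;>
    rcases hw' with ⟨hj', hw'⟩ | ⟨hj', hw'⟩ | ⟨hj', hw'⟩ <;>
    dsimp only at hj hj' hw hw' <;>
    first
    | rw [parentEdge_left hj] at heq
    | rw [parentEdge_middle hj] at heq
    | rw [parentEdge_right hj] at heq
  all_goals
    first
    | rw [parentEdge_left hj'] at heq
    | rw [parentEdge_middle hj'] at heq
    | rw [parentEdge_right hj'] at heq
  all_goals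
    simp only [reduceCtorEq, Sum.inl.injEq, Sum.inr.injEq, Prod.mk.injEq, Fin.ext_iff] at heq
  all_goals
    refine Prod.ext (Fin.ext ?_) (Fin.ext ?_) <;> dsimp only <;> omega

lemma IsFront.mirrorLab_parentEdge (h : P.IsFront c a) {w : (P.mirror (c + 1)).Vertex}
    (hw : P.IsContracted c a w) : P.mirrorLab c a (P.parentEdge c w) = .plus := by
  have hlt := h.lt
  have hlast := h.last
  rw [mirrorLab_plus]
  obtain ⟨i, j⟩ := w
  have hi : i.1 < P.N := i.2
  rcases hw with ⟨hj, hw, hw'⟩ | ⟨hj, hw⟩ | ⟨hj, hw⟩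
  · simp only at hj hw'
    rw [parentEdge_left hj]
    refine ⟨h.not_copy_inl.mpr ?_, ?_⟩
    · rw [foldCol, if_pos (by omega)]
      simp only
      omega
    · simp only [IsPlus]
      omega
  · simp only at hj hw
    rw [parentEdge_middle hj]
    refine ⟨h.not_copy_inr.mpr ?_, fun hc => ?_⟩
    · simp only [foldGap]
      rw [if_pos (by omega)]
      omega
    · simp only at hc
      omega
  · simp only at hj hw
    rw [parentEdge_right hj]
    refine ⟨h.not_copy_inr.mpr ?_, fun _ => hw⟩
    -- If the right horizontal edge were measured, the front vertex would be inner.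
    have hn : ¬ P.N + i.1 < a := fun hi => hw hlt (h.isInner_of_horizontal rfl hi)
    simp only [foldGap]
    rw [if_neg (by omega)]
    omega

lemma IsContracted.ends_parentEdge {w : (P.mirror (c + 1)).Vertex}
    (hw : P.IsContracted c a w) :
    ((P.mirror (c + 1)).graph.labelled (P.mirrorLab c a)).ends (P.parentEdge c w) =
      s(w, P.parent c w) := by
  obtain ⟨i, j⟩ := w
  refine Eq.trans ?_ Sym2.eq_swap
  change s((P.mirror (c + 1)).src (_, false), (P.mirror (c + 1)).src (_, true)) = _
  rcases hw with ⟨hj, hw, hw'⟩ | ⟨hj, hw⟩ | ⟨hj, hw⟩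
  · simp only at hj hw'
    rw [parentEdge_left hj, parent_left hj]
    refine congrArg (fun v => s(_, v)) (Prod.ext (Fin.ext ?_) rfl)
    change ((P.mirror (c + 1)).below j.1 _).1 = i.1
    rw [P.below_mirror (by omega), foldCol, if_pos (by omega)]
    have hj0 : j.1 = 0 := by omega
    have hi : i.1 < P.N := i.2
    refine (P.below_val (i := ⟨i.1 - 1, _⟩) (hj0 ▸ P.cut_zero) ?_).trans ?_ <;> simp only <;> omega
  · simp only at hj
    rw [parentEdge_middle hj, parent_middle hj]
    exact congrArg (fun v => s(_, v)) (Prod.ext rfl (Fin.ext hj.symm))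
  · simp only at hj
    rw [parentEdge_right hj, parent_right hj]
    exact congrArg (fun v => s(_, v)) (Prod.ext rfl (Fin.ext hj.symm))

lemma IsContracted.height_parent {w : (P.mirror (c + 1)).Vertex} (hw : P.IsContracted c a w) :
    P.height c (P.parent c w) < P.height c w := by
  obtain ⟨i, j⟩ := w
  have hi : i.1 < P.N := i.2
  rcases hw with ⟨hj, hw, hw'⟩ | ⟨hj, hw⟩ | ⟨hj, hw⟩
  · simp only at hj hw'
    rw [parent_left hj]
    simp only [height, if_pos hj]
    omega
  · simp only at hj
    rw [parent_middle hj]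
    simp only [height, hj, le_refl, if_true, Nat.not_succ_le_self, if_false]
    exact hi
  · simp only at hj
    rw [parent_right hj]
    simp only [height, hj]
    split_ifs <;> omega

lemma IsFront.contractPos_parent (h : P.IsFront c a) {w : (P.mirror (c + 1)).Vertex}
    (hw : P.IsContracted c a w) : contractPos h (P.parent c w) = contractPos h w := by
  have hlt := h.lt
  obtain ⟨i, j⟩ := w
  rcases hw with ⟨hj, hw, hw'⟩ | ⟨hj, hw⟩ | ⟨hj, hw⟩
  · simp only at hj hw'
    rw [parent_left hj, h.contractPos_left hj, h.contractPos_left hj]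
    congr 2
    refine Fin.ext ?_
    simp only [clampRow, if_pos hw]
    omega
  · simp only at hj hw
    rw [parent_middle hj, h.contractPos_middle' hj hw, h.contractPos_left le_rfl]
  · simp only at hj hw
    have hn : ¬ P.N + i.1 < a := fun hi => hw hlt (h.isInner_of_horizontal rfl hi)
    rw [parent_right hj, h.contractPos_middle' rfl fun hc => hn hc.2,
      h.contractPos_right' (m := ⟨c, hlt⟩) (by omega) (by simp only; omega) (hw hlt)]

/-- The forest uses up all `plus` edges, so no uncontracted one is left over. -/
lemma IsFront.exists_parentEdge (h : P.IsFront c a) {e : (P.mirror (c + 1)).Edge}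
    (he : P.mirrorLab c a e = .plus) :
    ∃ w, P.IsContracted c a w ∧ P.parentEdge c w = e := by
  obtain ⟨h1, h2⟩ := mirrorLab_plus.mp he
  rcases e with ⟨i, j⟩ | ⟨i, j⟩
  · obtain ⟨hc, hj, hi, hi'⟩ := h2
    exact ⟨(⟨i.1 + 1, hi'⟩, j), Or.inl ⟨by simp only; omega, hc, by simp only; omega⟩,
      parentEdge_left (by omega)⟩
  · have h3 := h.not_copy_inr.mp h1
    have hj : j.1 < 2 * (c + 1) + 1 - 1 := j.2
    by_cases hjc : c < j.1
    · have hj1 : j.1 = c + 1 := by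
        unfold foldGap at h3
        split_ifs at h3 <;> omega
      refine ⟨(i, ⟨c + 2, by simp only; omega⟩), Or.inr (Or.inr ⟨rfl, h2 hjc⟩), ?_⟩
      refine (parentEdge_right rfl).trans ?_
      exact congrArg (fun j => Sum.inr (i, j)) (Fin.ext hj1.symm)
    · have hf : foldGap (c + 1) j = j.1 := if_pos (by omega)
      rw [hf] at h3
      have hj1 : j.1 = c := by omega
      refine ⟨(i, ⟨c + 1, by simp only; omega⟩), Or.inr (Or.inl ⟨rfl, by simp only; omega⟩), ?_⟩
      refine (parentEdge_middle rfl).trans ?_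
      exact congrArg (fun j => Sum.inr (i, j)) (Fin.ext hj1.symm)

/-- The trees run from the glued mirror images to the mirror column, from there to the front column,
and, if the front is in column 0, up that column to row `a`. `height` decreases along each such
move. -/
lemma IsFront.isContraction (h : P.IsFront c a) : LabelledGraph.IsContraction
    (P.graph.double (P.part c a)) ((P.mirror (c + 1)).graph.labelled (P.mirrorLab c a))
    (contractVertex h) (fun v => P.copyPos c v.1.2 v.1.1) (fun e => P.copyEdge c e.2 e.1)
    (P.height c) (P.parent c) (fun w => P.parentEdge c w.1) where
  f_s := by
    rintro ⟨⟨v, b⟩, hv, hb⟩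
    refine Subtype.ext ((h.contractPos_copyPos b hv).trans ?_)
    simp only [Prod.mk.injEq, true_and]
    split_ifs with hvb
    · exact (hb hvb).symm
    · rfl
  h_inj := by
    rintro ⟨⟨e, he⟩, b⟩ ⟨⟨e', he'⟩, b'⟩ heq
    obtain ⟨rfl, rfl⟩ := h.copyEdge_inj he he' heq
    rfl
  lab_h := by
    rintro ⟨e, _ | _⟩
    · exact (h.mirrorLab_fst e _).mpr rfl
    · exact (h.mirrorLab_snd e _).mpr rfl
  ends_h := by
    rintro ⟨⟨⟨i, j⟩ | ⟨i, j⟩, he⟩, b⟩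
    · have hj : j.1 ≤ c := by
        have := h.inl_mem.mp he
        omega
      exact (congrArg₂ (fun u v => s(contractVertex h u, contractVertex h v))
        (src_copyEdge_inl b hj false) (src_copyEdge_inl b hj true)).trans
        (congrArg₂ (fun u v => s(u, v)) (h.contractVertex_copyPos b ⟨_, he, Or.inl rfl⟩)
          (h.contractVertex_copyPos b ⟨_, he, Or.inr rfl⟩))
    · have hj : j.1 ≤ c := by
        have := h.inr_mem.mp he
        omega
      refine (congrArg₂ (fun u v => s(contractVertex h u, contractVertex h v))
        (src_copyEdge_inr b hj false) (src_copyEdge_inr b hj true)).trans ?_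
      have h1 := h.contractVertex_copyPos b (v := P.src (.inr (i, j), false))
        ⟨_, he, Or.inl rfl⟩
      have h2 := h.contractVertex_copyPos b (v := P.src (.inr (i, j), true))
        ⟨_, he, Or.inr rfl⟩
      rcases b with _ | _
      · exact congrArg₂ (fun u v => s(u, v)) h1 h2
      · exact Sym2.eq_swap.trans (congrArg₂ (fun u v => s(u, v)) h1 h2)
  pe_inj w w' heq := Subtype.ext ((h.isContracted_iff.mp w.2).parentEdge_inj
    (h.isContracted_iff.mp w'.2) heq)
  lab_pe w := h.mirrorLab_parentEdge (h.isContracted_iff.mp w.2)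
  ends_pe w := (h.isContracted_iff.mp w.2).ends_parentEdge
  rank_par w hw := (h.isContracted_iff.mp hw).height_parent
  f_par w hw := Subtype.ext (h.contractPos_parent (h.isContracted_iff.mp hw))
  pe_ne_h := by
    rintro w ⟨e, b⟩ heq
    have h1 := h.mirrorLab_parentEdge (h.isContracted_iff.mp w.2)
    exact (mirrorLab_plus.mp h1).1 b e.1 e.2 heq
  other e := by
    rcases hl : P.mirrorLab c a e with e' | e' | _ | _
    · exact Or.inl ⟨(e', false), ((h.mirrorLab_fst e' e).mp hl).symm⟩
    · exact Or.inl ⟨(e', true), ((h.mirrorLab_snd e' e).mp hl).symm⟩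
    · exact Or.inr (Or.inl hl)
    · obtain ⟨w, hw, hwe⟩ := h.exists_parentEdge hl
      exact Or.inr (Or.inr ⟨⟨w, h.isContracted_iff.mpr hw⟩, hwe⟩)

end PuncturedCylinder

theorem theorem5p7 (P : PuncturedCylinder) (t : ℕ) (ht : 1 ≤ t)
    (ht' : t ≤ Fintype.card P.Edge) :
    ∃ (P' : PuncturedCylinder) (lab : P'.Edge → EdgeLabel {e // e ∈ P.measured t}),
      P'.genus ≤ 2 * P.genus ∧
      (P.graph.double (P.measured t)).Expands (P'.graph.labelled lab) ∧
      ∀ ψ ∈ P.graph.codeSpace, ∃ ψ' ∈ P'.graph.codeSpace,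
        ∀ φ : {e // e ∈ P.measured t} → Qubit,
          (partialProb (P.measured t) ψ φ : ℂ) =
            (Real.sqrt (2 ^ (Set.ncard {e | lab e = .zero ∨ lab e = .plus} + 1) /
              2 ^ (P.graph.boundary (P.measured t)).ncard) : ℝ) *
            braket (productState fun e => (lab e).qubit φ) ψ' := by
  obtain ⟨c, a, h, rfl⟩ := PuncturedCylinder.exists_isFront ht ht'
  have : Finite ((P.mirror (c + 1)).graph.labelled (P.mirrorLab c a)).E :=
    inferInstanceAs (Finite (P.mirror (c + 1)).Edge)
  refine ⟨P.mirror (c + 1), P.mirrorLab c a, P.genus_mirror_le _,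
    LabelledGraph.expands_of_isContraction _ rfl h.isContraction,
    fun ψ hψ => h.represents.exists_state hψ ?_⟩
  -- Only the nonvanishing of the prefactor matters, since the state is rescaled to match it.
  exact Complex.ofReal_ne_zero.mpr (Real.sqrt_pos.mpr (by positivity)).ne'
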